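/- Let $d\ge 1$ and let $(X_t)_{t\ge 0}$ be a time-homogeneous Markov process in $\mathbb R^d$ with transition kernels $p_t(x,B)=\mathbb P^x(X_t\in B)$ and transition semigroup $P_tf(x)=\mathbb E^x[f(X_t)]$. Assume that $X$ is a rich Feller process: $P_t$ maps $C_\infty(\mathbb R^d)$ (continuous functions vanishing at infinity, with the sup norm) into itself, $\|P_tf-f\|_\infty\to 0$ as $t\downarrow 0$ for every $f\in C_\infty(\mathbb R^d)$, and $C_c^\infty(\mathbb R^d)$ is contained in the domain of the Feller generator $\mathscr A f=\lim_{t\downarrow 0}(P_tf-f)/t$ (limit in sup norm). Assume that $\mathscr A$ is a Lévy-type operator with characteristic triplet $(a,b,\Pi)$, that is, for all $f\in C_c^\infty(\mathbb R^d)$ and $x\in\mathbb R^d$, $$\mathscr A f(x)=a(x)\cdot\nabla f(x)+\tfrac12\nabla\cdot b(x)\nabla f(x)+\int_{\mathbb R^d}\big(f(x+y)-f(x)-\nabla f(x)\cdot y\,\mathbf 1_{\{|y|<1\}}\big)\,\Pi(x,dy).$$ Here $a$ is an $\mathbb R^d$-valued Borel function; $b$ is a Borel function with values in the symmetric positive semidefinite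 $d\times d$ matrices; $\nabla\cdot b\nabla f:=\sum_j(\nabla\cdot b)_j\,\partial_jf+\sum_{i,j}b_{ij}\,\partial_i\partial_jf$, where $(\nabla\cdot b)_j=\sum_i\partial_ib_{ij}$ exists either classically at every point or as a fixed Borel, locally integrable version of the weak divergence of a locally integrable field $(b_{ij})_i$; and $\Pi$ is a Lévy kernel, i.e. $\Pi(\cdot,B)$ is Borel for every Borel set $B$, $\Pi(x,\{0\})=0$ and $\int(1\wedge|y|^2)\,\Pi(x,dy)<\infty$ for all $x$. Let $\pi=(\nu,\mu,\rho)=(h_\nu\Pi,h_\mu\Pi,h_\rho\Pi)$ be a convenient decomposition of $\Pi$: $h_\nu,h_\mu,h_\rho\ge 0$ are continuous functions of $y\in\mathbb R^d$, $\Pi=\nu+\mu+\rho$, and $\nu(x,\mathbb R^d)<\infty$, $\int(1\wedge|y|)\,\mu(x,dy)<\infty$, $\int(|y|\wedge|y|^2)\,\rho(x,dy)<\infty$ for all $x$. Put $$a_\pi(x)=-\int_{|y|<1}y\,\nu(x,dy)-\int_{|y|<1}y\,\mu(x,dy)+\int_{|y|\ge1}y\,\rho(x,dy).$$ For a kernel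 $\kappa$ let $\overline\kappa(x,B)=\int\int_0^{|y|}\mathbf 1_B(zy/|y|)\,dz\,\kappa(x,dy)$ be its integrated radial tail, and let $\overline{\overline\kappa}$ be the integrated radial tail of $\overline\kappa$. (If $\kappa(x,\cdot)$ has spherical part $\kappa_o(x,\cdot)$ and radial part $\kappa_\xi(x,\cdot)$ in polar coordinates, then $\overline\kappa(x,B)=\int_{S^{d-1}}\int_0^\infty\mathbf 1_B(z\xi)\,\kappa_\xi(x,(z,\infty))\,dz\,\kappa_o(x,d\xi)$.) For a measure $\eta$ on $\mathbb R^d$ and $f\in C_c^\infty(\mathbb R^d)$ put $$\begin{aligned} \langle\nabla\cdot((a+a_\pi)\eta),f\rangle&=-\int(a+a_\pi)\cdot\nabla f\,d\eta,\qquad \langle\tfrac12\nabla\cdot b\nabla\eta,f\rangle=\int\tfrac12\nabla\cdot b\nabla f\,d\eta,\\ \langle U^\pi(\eta),f\rangle&=\int\Big(\int f(x+y)\,\nu(x,dy)-f(x)\,\nu(x,\mathbb R^d)\Big)\eta(dx),\\ \langle\nabla\cdot V^\pi(\eta),f\rangle&=-\int\sum_i\int\partial_if(x+y)\,\frac{y_i}{|y|}\,\overline\mu(x,dy)\,\eta(dx),\\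 \langle\mathbf H\cdot W^\pi(\eta),f\rangle&=\int\sum_{i,j}\int\partial_i\partial_jf(x+y)\,\frac{y_iy_j}{|y|^2}\,\overline{\overline\rho}(x,dy)\,\eta(dx). \end{aligned}$$ Let $\eta\in\mathcal M(\mathscr A,\pi)$ be finite, where $\mathcal M(\mathscr A,\pi)$ is the class of measures $\eta$ for which each of these five functionals is well defined (its $\eta$-integral converges absolutely for every $f\in C_c^\infty(\mathbb R^d)$) and is a distribution on $\mathbb R^d$. Consider the distributional equation $$-\nabla\cdot((a+a_\pi)\eta)+\tfrac12\nabla\cdot b\nabla\eta+U^\pi(\eta)-\nabla\cdot V^\pi(\eta)+\mathbf H\cdot W^\pi(\eta)=0.\tag{1}$$ If some core of $(\mathscr A,\mathscr D(\mathscr A))$ is contained in $C_c^\infty(\mathbb R^d)$ and $\eta$ solves (1), then $\eta$ is invariant for $X$, i.e. $\int p_t(x,B)\,\eta(dx)=\eta(B)$ for all $t\ge 0$ and all Borel sets $B$. Conversely (without any assumption on a core), if $\eta$ is invariant for $X$, then $\eta$ solves (1). -/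

import Mathlib

open MeasureTheory ProbabilityTheory Filter Topology Set
open scoped NNReal ENNReal Distributions ZeroAtInfty

namespace LevyTypeInvariant

noncomputable section

/-! ### Test functions, functions vanishing at infinity, derivatives -/

/-- The state space `ℝ^d` with its Euclidean norm. -/
abbrev Rd (d : ℕ) : Type := EuclideanSpace ℝ (Fin d)

/-- The space `C_c^∞(ℝ^d)` of test functions. -/
abbrev TestFn (d : ℕ) : Type := 𝓓((⊤ : TopologicalSpace.Opens (Rd d)), ℝ)

/-- The space of distributions on `ℝ^d`. -/
abbrev Distr (d : ℕ) : Type := 𝓓'((⊤ : TopologicalSpace.Opens (Rd d)), ℝ)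

/-- The `i`-th standard basis vector. -/
abbrev basisVec {d : ℕ} (i : Fin d) : Rd d := EuclideanSpace.single i (1 : ℝ)

/-- The partial derivative `∂_i f` (only used for smooth `f`). -/
def pderiv {d : ℕ} (i : Fin d) (f : Rd d → ℝ) (x : Rd d) : ℝ := fderiv ℝ f x (basisVec i)

/-- The inclusion of `C_c^∞(ℝ^d)` into the space of continuous functions vanishing at infinity. -/
def testToC0 {d : ℕ} (f : TestFn d) : C₀(Rd d, ℝ) where
  toFun := f
  continuous_toFun := f.continuous
  zero_at_infty' := by
    have h := f.hasCompactSupport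
    rw [hasCompactSupport_iff_eventuallyEq, coclosedCompact_eq_cocompact] at h
    exact (tendsto_congr' h).2 tendsto_const_nhds

/-! ### Markov processes and Feller processes -/

/-- A time-homogeneous Markov process in `E`, given by its family of laws `ℙ^x`, `x ∈ E`: under
`ℙ^x` the process starts in `x`, and
`ℙ^x (X_{s+t} ∈ B | σ(X_u : u ≤ s)) = ℙ^{X_s} (X_t ∈ B)` almost surely. -/
structure MarkovProcess (E : Type*) (Ω : Type*) [MeasurableSpace E] [MeasurableSpace Ω] where
  /-- The process. -/
  X : ℝ≥0 → Ω → E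
  /-- The law of the process started in a given point. -/
  law : Kernel E Ω
  measurable_X : ∀ t, Measurable (X t)
  isMarkovKernel_law : IsMarkovKernel law
  start : ∀ x, ∀ᵐ ω ∂(law x), X 0 ω = x
  markov : ∀ (x : E) (s t : ℝ≥0) (B : Set E), MeasurableSet B →
    (law x)[(X (s + t) ⁻¹' B).indicator (fun _ => (1 : ℝ)) |
        ⨆ u : Iic s, MeasurableSpace.comap (X u) inferInstance]
      =ᵐ[law x] fun ω => (law (X s ω)).real (X t ⁻¹' B)

namespace MarkovProcess

variable {E Ω : Type*} [MeasurableSpace E] [MeasurableSpace Ω]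

/-- The transition kernel `p_t(x, B) = ℙ^x (X_t ∈ B)`. -/
def transition (X : MarkovProcess E Ω) (t : ℝ≥0) : Kernel E E := X.law.map (X.X t)

/-- The transition semigroup `P_t f (x) = 𝔼^x [f (X_t)]`. -/
def semigroup (X : MarkovProcess E Ω) (t : ℝ≥0) (f : E → ℝ) (x : E) : ℝ :=
  ∫ ω, f (X.X t ω) ∂(X.law x)

/-- `η` is invariant for `X` if `∫ p_t(x, B) η(dx) = η(B)` for all `t ≥ 0` and all
measurable `B`. -/
def IsInvariant (X : MarkovProcess E Ω) (η : Measure E) : Prop :=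
  ∀ (t : ℝ≥0) (B : Set E), MeasurableSet B → ∫⁻ x, X.transition t x B ∂η = η B

end MarkovProcess

/-- The Feller property: `P_t` maps `C_∞(ℝ^d)` into itself, and `P_t f → f` uniformly as `t ↓ 0`. -/
structure IsFeller {d : ℕ} {Ω : Type*} [MeasurableSpace Ω] (X : MarkovProcess (Rd d) Ω) :
    Prop where
  maps_C0 : ∀ (t : ℝ≥0) (f : C₀(Rd d, ℝ)), ∃ g : C₀(Rd d, ℝ), ∀ x, g x = X.semigroup t f x
  tendsto_id : ∀ f : C₀(Rd d, ℝ),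
    TendstoUniformly (fun (t : ℝ≥0) x => X.semigroup t f x) f (𝓝[>] 0)

theorem integrable_C0 {d : ℕ} {Ω : Type*} [MeasurableSpace Ω] (X : MarkovProcess (Rd d) Ω)
    (t : ℝ≥0) (x : Rd d) (f : C₀(Rd d, ℝ)) :
    Integrable (fun ω => f (X.X t ω)) (X.law x) := by
  have := X.isMarkovKernel_law
  refine Integrable.of_bound (C := ‖f‖)
    ((map_continuous f).measurable.comp (X.measurable_X t)).aestronglyMeasurable
    (Eventually.of_forall fun ω => ?_)
  exact (f.toBCF).norm_coe_le_norm (X.X t ω)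

/-- The graph of the Feller generator: the pairs `(f, g)` in `C_∞(ℝ^d)` such that
`(P_t f - f) / t → g` uniformly as `t ↓ 0`. -/
def generatorGraph {d : ℕ} {Ω : Type*} [MeasurableSpace Ω] (X : MarkovProcess (Rd d) Ω) :
    Submodule ℝ (C₀(Rd d, ℝ) × C₀(Rd d, ℝ)) where
  carrier := {p | TendstoUniformly
    (fun (t : ℝ≥0) x => (X.semigroup t p.1 x - p.1 x) / (t : ℝ)) p.2 (𝓝[>] 0)}
  zero_mem' := by
    have h : (fun (t : ℝ≥0) (x : Rd d) =>
        (X.semigroup t (0 : C₀(Rd d, ℝ)) x - (0 : C₀(Rd d, ℝ)) x) / (t : ℝ)) =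
        fun _ _ => (0 : ℝ) := by
      funext t x
      simp [MarkovProcess.semigroup]
    change TendstoUniformly (fun (t : ℝ≥0) (x : Rd d) =>
        (X.semigroup t (0 : C₀(Rd d, ℝ)) x - (0 : C₀(Rd d, ℝ)) x) / (t : ℝ))
        (0 : C₀(Rd d, ℝ)) (𝓝[>] 0)
    rw [h]
    exact fun u hu => Eventually.of_forall fun t x => by simpa using refl_mem_uniformity hu
  add_mem' := by
    intro p q hp hq
    have h : (fun (t : ℝ≥0) (x : Rd d) =>
        (X.semigroup t (p + q).1 x - (p + q).1 x) / (t : ℝ)) =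
        (fun (t : ℝ≥0) (x : Rd d) => (X.semigroup t p.1 x - p.1 x) / (t : ℝ)) +
        (fun (t : ℝ≥0) (x : Rd d) => (X.semigroup t q.1 x - q.1 x) / (t : ℝ)) := by
      funext t x
      have := integral_add (integrable_C0 X t x p.1) (integrable_C0 X t x q.1)
      simp only [MarkovProcess.semigroup, Prod.fst_add, ZeroAtInftyContinuousMap.coe_add,
        Pi.add_apply, this]
      ring
    change TendstoUniformly (fun (t : ℝ≥0) (x : Rd d) =>
        (X.semigroup t (p + q).1 x - (p + q).1 x) / (t : ℝ)) (p + q).2 (𝓝[>] 0)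
    rw [h]
    exact TendstoUniformly.add hp hq
  smul_mem' := by
    intro c p hp
    have h : (fun (t : ℝ≥0) (x : Rd d) =>
        (X.semigroup t (c • p).1 x - (c • p).1 x) / (t : ℝ)) =
        (fun (t : ℝ≥0) => (fun r : ℝ => c * r) ∘
          (fun x : Rd d => (X.semigroup t p.1 x - p.1 x) / (t : ℝ))) := by
      funext t x
      simp only [MarkovProcess.semigroup, Prod.smul_fst, ZeroAtInftyContinuousMap.coe_smul,
        Pi.smul_apply, smul_eq_mul, integral_const_mul, Function.comp]
      ring
    change TendstoUniformly (fun (t : ℝ≥0) (x : Rd d) =>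
        (X.semigroup t (c • p).1 x - (c • p).1 x) / (t : ℝ)) (c • p).2 (𝓝[>] 0)
    rw [h]
    exact (uniformContinuous_const_smul c).comp_tendstoUniformly hp

theorem generatorGraph_functional {d : ℕ} {Ω : Type*} [MeasurableSpace Ω]
    (X : MarkovProcess (Rd d) Ω) (p : C₀(Rd d, ℝ) × C₀(Rd d, ℝ)) (hp : p ∈ generatorGraph X)
    (h0 : p.1 = 0) : p.2 = 0 := by
  ext x
  have hp' : TendstoUniformly
    (fun (t : ℝ≥0) x => (X.semigroup t p.1 x - p.1 x) / (t : ℝ)) p.2 (𝓝[>] 0) := hp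
  have h := hp'.tendsto_at x
  rw [h0] at h
  have h1 : (fun t : ℝ≥0 => (X.semigroup t (0 : C₀(Rd d, ℝ)) x - (0 : C₀(Rd d, ℝ)) x) / (t : ℝ))
      = fun _ => (0 : ℝ) := by
    funext t
    simp [MarkovProcess.semigroup]
  rw [h1] at h
  exact tendsto_nhds_unique h tendsto_const_nhds

/-- The Feller generator `(𝒜, D(𝒜))`, an unbounded operator on `C_∞(ℝ^d)`. -/
def generator {d : ℕ} {Ω : Type*} [MeasurableSpace Ω] (X : MarkovProcess (Rd d) Ω) :
    C₀(Rd d, ℝ) →ₗ.[ℝ] C₀(Rd d, ℝ) :=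
  (generatorGraph X).toLinearPMap

/-- `(f, g)` belongs to the graph of the generator iff `(P_t f - f) / t → g` uniformly. -/
theorem mem_graph_generator {d : ℕ} {Ω : Type*} [MeasurableSpace Ω]
    (X : MarkovProcess (Rd d) Ω) (f g : C₀(Rd d, ℝ)) :
    (f, g) ∈ (generator X).graph ↔ TendstoUniformly
      (fun (t : ℝ≥0) x => (X.semigroup t f x - f x) / (t : ℝ)) g (𝓝[>] 0) := by
  rw [generator, Submodule.toLinearPMap_graph_eq _ (generatorGraph_functional X)]
  rfl

/-- A Feller process is rich if `C_c^∞(ℝ^d)` is contained in the domain of its generator. -/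
def IsRichFeller {d : ℕ} {Ω : Type*} [MeasurableSpace Ω] (X : MarkovProcess (Rd d) Ω) : Prop :=
  IsFeller X ∧ ∀ f : TestFn d, testToC0 f ∈ (generator X).domain

/-! ### Lévy-type operators -/

/-- `g` is the divergence of the vector field `F`: either all partial derivatives `∂_i F_i` exist
everywhere and `g = ∑ i, ∂_i F_i`, or `F` is locally integrable and `g` is a (fixed) locally
integrable version of its weak divergence. -/
def HasDivergence {d : ℕ} (F : Rd d → Fin d → ℝ) (g : Rd d → ℝ) : Prop :=
  (∀ x, (∀ i, LineDifferentiableAt ℝ (fun y => F y i) x (basisVec i)) ∧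
    g x = ∑ i, lineDeriv ℝ (fun y => F y i) x (basisVec i)) ∨
  ((∀ i, LocallyIntegrable (fun y => F y i)) ∧ LocallyIntegrable g ∧
    ∀ φ : TestFn d, ∫ x, ∑ i, F x i * pderiv i φ x = - ∫ x, g x * φ x)

/-- A characteristic triplet `(a, b, Π)`. The field `divb` is the vector field `∇ · b` with
components `(∇ · b)_j = ∑ i, ∂_i b_{ij}`, which gives a meaning to `∇ · (b ∇f)`. -/
structure Triplet (d : ℕ) where
  a : Rd d → Rd d
  b : Rd d → Matrix (Fin d) (Fin d) ℝ
  divb : Rd d → Rd d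
  /-- The Lévy kernel. -/
  Pi : Kernel (Rd d) (Rd d)
  measurable_a : Measurable a
  measurable_b : ∀ i j, Measurable fun x => b x i j
  posSemidef_b : ∀ x, (b x).PosSemidef
  measurable_divb : Measurable divb
  divb_eq : ∀ j, HasDivergence (fun x i => b x i j) (fun x => divb x j)
  Pi_zero : ∀ x, Pi x {0} = 0
  levy : ∀ x, ∫⁻ y, ENNReal.ofReal (min 1 (‖y‖ ^ 2)) ∂(Pi x) < ⊤

/-- `∇ · (b ∇f) = ∑ j, (∇ · b)_j ∂_j f + ∑ i j, b_{ij} ∂_i ∂_j f`. -/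
def Triplet.divForm {d : ℕ} (T : Triplet d) (f : Rd d → ℝ) (x : Rd d) : ℝ :=
  ∑ j, T.divb x j * pderiv j f x + ∑ i, ∑ j, T.b x i j * pderiv i (pderiv j f) x

/-- The integro-differential expression
`a(x) · ∇f(x) + 1/2 ∇ · b(x) ∇f(x) + ∫ (f(x+y) - f(x) - ∇f(x) · y 1_{|y|<1}) Π(x, dy)`. -/
def Triplet.op {d : ℕ} (T : Triplet d) (f : Rd d → ℝ) (x : Rd d) : ℝ :=
  ∑ i, T.a x i * pderiv i f x + (1 / 2) * T.divForm f x +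
    ∫ y, (f (x + y) - f x -
      (Metric.ball (0 : Rd d) 1).indicator (fun z => ∑ i, pderiv i f x * z i) y) ∂(T.Pi x)

/-- The operator `A` on `C_∞(ℝ^d)` is, on the test functions in its domain, the Lévy-type operator
with characteristic triplet `T`. -/
def IsLevyTypeOperator {d : ℕ} (A : C₀(Rd d, ℝ) →ₗ.[ℝ] C₀(Rd d, ℝ)) (T : Triplet d) : Prop :=
  ∀ (f : TestFn d) (hf : testToC0 f ∈ A.domain) (x : Rd d), A ⟨testToC0 f, hf⟩ x = T.op f x

/-! ### Convenient decompositions and integrated radial tails -/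

/-- The measure `h(y) P(dy)`. -/
def weighted {d : ℕ} (h : Rd d → ℝ) (P : Measure (Rd d)) : Measure (Rd d) :=
  P.withDensity fun y => ENNReal.ofReal (h y)

/-- A convenient decomposition `π = (ν, μ, ρ) = (h_ν Π, h_μ Π, h_ρ Π)` of the kernel `Π`. -/
structure ConvenientDecomposition {d : ℕ} (Pi : Kernel (Rd d) (Rd d)) where
  hν : Rd d → ℝ
  hμ : Rd d → ℝ
  hρ : Rd d → ℝ
  continuous_hν : Continuous hν
  continuous_hμ : Continuous hμ
  continuous_hρ : Continuous hρ
  nonneg_hν : ∀ y, 0 ≤ hν y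
  nonneg_hμ : ∀ y, 0 ≤ hμ y
  nonneg_hρ : ∀ y, 0 ≤ hρ y
  sum_eq : ∀ x, Pi x = weighted hν (Pi x) + weighted hμ (Pi x) + weighted hρ (Pi x)
  finite_ν : ∀ x, weighted hν (Pi x) univ < ⊤
  finite_μ : ∀ x, ∫⁻ y, ENNReal.ofReal (min 1 ‖y‖) ∂(weighted hμ (Pi x)) < ⊤
  finite_ρ : ∀ x, ∫⁻ y, ENNReal.ofReal (min ‖y‖ (‖y‖ ^ 2)) ∂(weighted hρ (Pi x)) < ⊤

namespace ConvenientDecomposition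

variable {d : ℕ} {Pi : Kernel (Rd d) (Rd d)} (π : ConvenientDecomposition Pi)

/-- The large jump kernel. -/
def ν (x : Rd d) : Measure (Rd d) := weighted π.hν (Pi x)

/-- The medium jump kernel. -/
def μ (x : Rd d) : Measure (Rd d) := weighted π.hμ (Pi x)

/-- The small jump kernel. -/
def ρ (x : Rd d) : Measure (Rd d) := weighted π.hρ (Pi x)

/-- `a_π(x) = - ∫_{|y|<1} y ν(x,dy) - ∫_{|y|<1} y μ(x,dy) + ∫_{|y|≥1} y ρ(x,dy)`. -/
def aπ (x : Rd d) : Rd d :=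
  - (∫ y in Metric.ball 0 1, y ∂(π.ν x)) - (∫ y in Metric.ball 0 1, y ∂(π.μ x))
    + ∫ y in (Metric.ball 0 1)ᶜ, y ∂(π.ρ x)

end ConvenientDecomposition

/-- The integrated radial tail of `P`: the measure
`B ↦ ∫ P(dy) ∫_{0<z<|y|} 1_B (z y/|y|) dz`. For every polar decomposition of `P` into a spherical
part `σ` and a radial part `R`, it is the measure
`B ↦ ∫ σ(dξ) ∫_{z>0} 1_B (zξ) R_ξ((z,∞)) dz`; see `radialTail_polar` below. -/
def radialTail {d : ℕ} (P : Measure (Rd d)) : Measure (Rd d) :=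
  ((P.prod (volume : Measure ℝ)).restrict {p | 0 < p.2 ∧ p.2 < ‖p.1‖}).map
    fun p => p.2 • (‖p.1‖⁻¹ • p.1)

/-- The double-integrated radial tail of `P`. For every polar decomposition of `P` it is the measure
`B ↦ ∫ σ(dξ) ∫_{z>0} 1_B (zξ) ∫_{w>z} R_ξ((w,∞)) dw dz`; see `doubleRadialTail_polar` below. -/
def doubleRadialTail {d : ℕ} (P : Measure (Rd d)) : Measure (Rd d) := radialTail (radialTail P)

/-- A polar decomposition of `P`: a finite measure `σ` on the unit sphere (the spherical part) and a
measurable family `(R_ξ)` of measures on `(0,∞)` (the radial part) such that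
`P(B) = ∫ σ(dξ) ∫ 1_B (rξ) R_ξ(dr)`. -/
structure IsPolarDecomposition {d : ℕ} (P : Measure (Rd d))
    (σ : Measure (Metric.sphere (0 : Rd d) 1)) (R : Kernel (Metric.sphere (0 : Rd d) 1) ℝ) :
    Prop where
  finite_spherical : IsFiniteMeasure σ
  sFinite_radial : IsSFiniteKernel R
  radial_pos : ∀ ξ, R ξ (Iic 0) = 0
  eq_lintegral : ∀ B, MeasurableSet B →
    P B = ∫⁻ ξ, ∫⁻ r, B.indicator 1 (r • (ξ : Rd d)) ∂(R ξ) ∂σ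

theorem measurable_radial (d : ℕ) :
    Measurable fun p : Rd d × ℝ => p.2 • (‖p.1‖⁻¹ • p.1) := by fun_prop

theorem lintegral_radialTail {d : ℕ} (P : Measure (Rd d)) {f : Rd d → ℝ≥0∞} (hf : Measurable f) :
    ∫⁻ u, f u ∂(radialTail P) =
      ∫⁻ y, (∫⁻ z in Ioo 0 ‖y‖, f (z • (‖y‖⁻¹ • y))) ∂P := by
  have hS : MeasurableSet {p : Rd d × ℝ | 0 < p.2 ∧ p.2 < ‖p.1‖} :=
    (measurableSet_lt measurable_const measurable_snd).inter
      (measurableSet_lt measurable_snd measurable_fst.norm)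
  have hm := hf.comp (measurable_radial d)
  rw [radialTail, lintegral_map hf (measurable_radial d), ← lintegral_indicator hS]
  refine (lintegral_prod _ (hm.indicator hS).aemeasurable).trans ?_
  refine lintegral_congr fun y => ?_
  rw [← lintegral_indicator measurableSet_Ioo]
  rfl

theorem measurable_inner_radialTail {d : ℕ} {f : Rd d → ℝ≥0∞} (hf : Measurable f) :
    Measurable fun y : Rd d => ∫⁻ z in Ioo 0 ‖y‖, f (z • (‖y‖⁻¹ • y)) := by
  have hS : MeasurableSet {p : Rd d × ℝ | 0 < p.2 ∧ p.2 < ‖p.1‖} :=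
    (measurableSet_lt measurable_const measurable_snd).inter
      (measurableSet_lt measurable_snd measurable_fst.norm)
  have hm := (hf.comp (measurable_radial d)).indicator hS
  have := hm.lintegral_prod_right' (ν := (volume : Measure ℝ))
  have h : (fun y : Rd d => ∫⁻ z in Ioo 0 ‖y‖, f (z • (‖y‖⁻¹ • y))) = fun y =>
      ∫⁻ z : ℝ, {p : Rd d × ℝ | 0 < p.2 ∧ p.2 < ‖p.1‖}.indicator
        (f ∘ fun p : Rd d × ℝ => p.2 • (‖p.1‖⁻¹ • p.1)) (y, z) := by
    funext y
    rw [← lintegral_indicator measurableSet_Ioo]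
    rfl
  rw [h]
  exact this

theorem IsPolarDecomposition.lintegral_eq {d : ℕ} {P : Measure (Rd d)}
    {σ : Measure (Metric.sphere (0 : Rd d) 1)} {R : Kernel (Metric.sphere (0 : Rd d) 1) ℝ}
    (h : IsPolarDecomposition P σ R) {g : Rd d → ℝ≥0∞} (hg : Measurable g) :
    ∫⁻ y, g y ∂P = ∫⁻ ξ, ∫⁻ r, g (r • (ξ : Rd d)) ∂(R ξ) ∂σ := by
  have := h.finite_spherical
  have := h.sFinite_radial
  have hm : Measurable fun p : Metric.sphere (0 : Rd d) 1 × ℝ => p.2 • (p.1 : Rd d) := by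
    fun_prop
  have hP : P = (σ.compProd R).map fun p => p.2 • (p.1 : Rd d) := by
    ext B hB
    rw [h.eq_lintegral B hB, ← lintegral_indicator_one hB,
      lintegral_map (measurable_one.indicator hB) hm]
    exact (Measure.lintegral_compProd ((measurable_one.indicator hB).comp hm)).symm
  rw [hP, lintegral_map hg hm]
  exact Measure.lintegral_compProd (hg.comp hm)

theorem lintegral_radialTail_polar {d : ℕ} {P : Measure (Rd d)}
    {σ : Measure (Metric.sphere (0 : Rd d) 1)} {R : Kernel (Metric.sphere (0 : Rd d) 1) ℝ}
    (h : IsPolarDecomposition P σ R) {f : Rd d → ℝ≥0∞} (hf : Measurable f) :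
    ∫⁻ u, f u ∂(radialTail P) =
      ∫⁻ ξ, (∫⁻ z in Ioi (0 : ℝ), f (z • (ξ : Rd d)) * R ξ (Ioi z)) ∂σ := by
  have := h.sFinite_radial
  rw [lintegral_radialTail P hf, h.lintegral_eq (measurable_inner_radialTail hf)]
  refine lintegral_congr fun ξ => ?_
  have hξ : ‖(ξ : Rd d)‖ = 1 := by simp
  have hpos : ∀ᵐ r ∂(R ξ), 0 < r := by
    rw [ae_iff]
    simpa [Iic] using h.radial_pos ξ
  have h1 : ∫⁻ r, (∫⁻ z in Ioo 0 ‖r • (ξ : Rd d)‖,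
        f (z • (‖r • (ξ : Rd d)‖⁻¹ • (r • (ξ : Rd d))))) ∂(R ξ) =
      ∫⁻ r, (∫⁻ z in Ioi (0 : ℝ), {p : ℝ × ℝ | p.2 < p.1}.indicator
        (fun p => f (p.2 • (ξ : Rd d))) (r, z)) ∂(R ξ) := by
    refine lintegral_congr_ae ?_
    filter_upwards [hpos] with r hr
    rw [norm_smul, hξ, mul_one, Real.norm_of_nonneg hr.le, smul_smul, inv_mul_cancel₀ hr.ne',
      one_smul, ← Ioi_inter_Iio, inter_comm, ← Measure.restrict_restrict measurableSet_Iio,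
      ← lintegral_indicator measurableSet_Iio]
    rfl
  have hT : MeasurableSet {p : ℝ × ℝ | p.2 < p.1} := measurableSet_lt measurable_snd measurable_fst
  have hF : Measurable fun p : ℝ × ℝ => f (p.2 • (ξ : Rd d)) := by fun_prop
  rw [h1, lintegral_lintegral_swap
    (f := fun r z => {p : ℝ × ℝ | p.2 < p.1}.indicator (fun p => f (p.2 • (ξ : Rd d))) (r, z))
    (hF.indicator hT).aemeasurable]
  refine lintegral_congr fun z => ?_
  have h2 : ∀ r, {p : ℝ × ℝ | p.2 < p.1}.indicator (fun p => f (p.2 • (ξ : Rd d))) (r, z) =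
      (Ioi z).indicator (fun _ => f (z • (ξ : Rd d))) r := fun r => rfl
  simp_rw [h2]
  rw [lintegral_indicator_const measurableSet_Ioi]

theorem radialTail_polar {d : ℕ} {P : Measure (Rd d)}
    {σ : Measure (Metric.sphere (0 : Rd d) 1)} {R : Kernel (Metric.sphere (0 : Rd d) 1) ℝ}
    (h : IsPolarDecomposition P σ R) {B : Set (Rd d)} (hB : MeasurableSet B) :
    radialTail P B =
      ∫⁻ ξ, (∫⁻ z in Ioi (0 : ℝ), B.indicator 1 (z • (ξ : Rd d)) * R ξ (Ioi z)) ∂σ := by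
  rw [← lintegral_indicator_one hB,
    lintegral_radialTail_polar h (measurable_one.indicator hB)]

theorem doubleRadialTail_polar {d : ℕ} {P : Measure (Rd d)}
    {σ : Measure (Metric.sphere (0 : Rd d) 1)} {R : Kernel (Metric.sphere (0 : Rd d) 1) ℝ}
    (h : IsPolarDecomposition P σ R) {B : Set (Rd d)} (hB : MeasurableSet B) :
    doubleRadialTail P B =
      ∫⁻ ξ, (∫⁻ z in Ioi (0 : ℝ), B.indicator 1 (z • (ξ : Rd d)) *
        (∫⁻ w in Ioi z, R ξ (Ioi w))) ∂σ := by
  have hB1 : Measurable (B.indicator (1 : Rd d → ℝ≥0∞)) := measurable_one.indicator hB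
  rw [← lintegral_indicator_one hB, doubleRadialTail, lintegral_radialTail _ hB1,
    lintegral_radialTail_polar h (measurable_inner_radialTail hB1)]
  refine lintegral_congr fun ξ => ?_
  have hξ : ‖(ξ : Rd d)‖ = 1 := by simp
  have hR : Measurable fun w : ℝ => R ξ (Ioi w) :=
    Antitone.measurable fun u v huv => measure_mono (Ioi_subset_Ioi huv)
  have hf : Measurable fun z : ℝ => B.indicator (1 : Rd d → ℝ≥0∞) (z • (ξ : Rd d)) := by
    fun_prop
  have hT : MeasurableSet {p : ℝ × ℝ | p.2 < p.1} := measurableSet_lt measurable_snd measurable_fst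
  have hF : Measurable fun p : ℝ × ℝ =>
      B.indicator (1 : Rd d → ℝ≥0∞) (p.2 • (ξ : Rd d)) * R ξ (Ioi p.1) :=
    (hf.comp measurable_snd).mul (hR.comp measurable_fst)
  have h1 : ∫⁻ w in Ioi (0 : ℝ), (∫⁻ z in Ioo 0 ‖w • (ξ : Rd d)‖, B.indicator (1 : Rd d → ℝ≥0∞)
        (z • (‖w • (ξ : Rd d)‖⁻¹ • (w • (ξ : Rd d))))) * R ξ (Ioi w) =
      ∫⁻ w in Ioi (0 : ℝ), ∫⁻ z in Ioi (0 : ℝ), {p : ℝ × ℝ | p.2 < p.1}.indicator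
        (fun p => B.indicator (1 : Rd d → ℝ≥0∞) (p.2 • (ξ : Rd d)) * R ξ (Ioi p.1)) (w, z) := by
    refine setLIntegral_congr_fun measurableSet_Ioi fun w hw => ?_
    have hw : (0 : ℝ) < w := hw
    rw [norm_smul, hξ, mul_one, Real.norm_of_nonneg hw.le, smul_smul, inv_mul_cancel₀ hw.ne',
      one_smul, ← Ioi_inter_Iio, inter_comm, ← Measure.restrict_restrict measurableSet_Iio,
      ← lintegral_mul_const _ hf, ← lintegral_indicator measurableSet_Iio]
    rfl
  rw [h1, lintegral_lintegral_swap
    (f := fun w z => {p : ℝ × ℝ | p.2 < p.1}.indicator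
      (fun p => B.indicator (1 : Rd d → ℝ≥0∞) (p.2 • (ξ : Rd d)) * R ξ (Ioi p.1)) (w, z))
    (hF.indicator hT).aemeasurable]
  refine setLIntegral_congr_fun measurableSet_Ioi fun z hz => ?_
  have hz : (0 : ℝ) < z := hz
  have h2 : ∀ w, {p : ℝ × ℝ | p.2 < p.1}.indicator
      (fun p => B.indicator (1 : Rd d → ℝ≥0∞) (p.2 • (ξ : Rd d)) * R ξ (Ioi p.1)) (w, z) =
      (Ioi z).indicator
        (fun w => B.indicator (1 : Rd d → ℝ≥0∞) (z • (ξ : Rd d)) * R ξ (Ioi w)) w := fun w => rfl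
  simp_rw [h2]
  rw [lintegral_indicator measurableSet_Ioi, Measure.restrict_restrict measurableSet_Ioi,
    Ioi_inter_Ioi, sup_eq_left.2 hz.le, lintegral_const_mul _ hR]

/-! ### Jump functionals, the class `M(A, π)` and the distributional equation -/

section Functionals

variable {d : ℕ} (T : Triplet d) (π : ConvenientDecomposition T.Pi)

/-- `f ↦ ∫ I f x η(dx)` defines a distribution: the integral converges for all test functions `f`,
and depends on `f` linearly and continuously. -/
def DefinesDistribution (I : TestFn d → Rd d → ℝ) (η : Measure (Rd d)) : Prop :=
  (∀ f, Integrable (I f) η) ∧ ∃ S : Distr d, ∀ f, S f = ∫ x, I f x ∂η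

/-- The integrand of `⟨∇ · ((a + a_π) η), f⟩ = - ∫ (a + a_π) · ∇f dη`. -/
def driftIntegrand (f : TestFn d) (x : Rd d) : ℝ :=
  - ∑ i, (T.a x + π.aπ x) i * pderiv i f x

/-- The integrand of `⟨1/2 ∇ · b ∇η, f⟩ = ∫ 1/2 ∇ · (b ∇f) dη`. -/
def diffusionIntegrand (f : TestFn d) (x : Rd d) : ℝ := (1 / 2) * T.divForm f x

variable {T}

/-- The integrand of `⟨U^π(η), f⟩ = ∫ (∫ f(x+y) ν(x,dy) - f(x) ν(x,ℝ^d)) η(dx)`. -/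
def jumpU (f : Rd d → ℝ) (x : Rd d) : ℝ :=
  (∫ y, f (x + y) ∂(π.ν x)) - f x * (π.ν x).real univ

/-- The integrand of `⟨V_i^π(η), f⟩ = ∫ (∫ f(x+y) y_i/|y| μ̄(x,dy)) η(dx)`, where `μ̄` is the
integrated radial tail of `μ`. -/
def jumpV (i : Fin d) (f : Rd d → ℝ) (x : Rd d) : ℝ :=
  ∫ y, f (x + y) * (y i / ‖y‖) ∂(radialTail (π.μ x))

/-- The integrand of `⟨W_{ij}^π(η), f⟩ = ∫ (∫ f(x+y) y_i y_j/|y|^2 ρ̿(x,dy)) η(dx)`, where `ρ̿` is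
the double-integrated radial tail of `ρ`. -/
def jumpW (i j : Fin d) (f : Rd d → ℝ) (x : Rd d) : ℝ :=
  ∫ y, f (x + y) * (y i * y j / ‖y‖ ^ 2) ∂(doubleRadialTail (π.ρ x))

/-- The integrand of `⟨∇ · V^π(η), f⟩ = - ∑ i, ⟨V_i^π(η), ∂_i f⟩`. -/
def divVIntegrand (f : TestFn d) (x : Rd d) : ℝ := - ∑ i, jumpV π i (pderiv i f) x

/-- The integrand of `⟨H · W^π(η), f⟩ = ∑ i j, ⟨W_{ij}^π(η), ∂_i ∂_j f⟩`. -/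
def hessWIntegrand (f : TestFn d) (x : Rd d) : ℝ :=
  ∑ i, ∑ j, jumpW π i j (pderiv i (pderiv j f)) x

variable (T)

/-- The class `M(A, π)` of measures for which all terms of the distributional equation define
distributions. -/
structure MemM (η : Measure (Rd d)) : Prop where
  drift : DefinesDistribution (driftIntegrand T π) η
  diffusion : DefinesDistribution (diffusionIntegrand T) η
  jumpU : DefinesDistribution (fun f => jumpU π f) η
  divV : DefinesDistribution (divVIntegrand π) η
  hessW : DefinesDistribution (hessWIntegrand π) η

/-- `η` solves the distributional equation
`- ∇ · ((a + a_π) η) + 1/2 ∇ · b ∇η + U^π(η) - ∇ · V^π(η) + H · W^π(η) = 0`. -/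
def SolvesDistributionalEquation (η : Measure (Rd d)) : Prop :=
  ∀ f : TestFn d,
    - (∫ x, driftIntegrand T π f x ∂η) + (∫ x, diffusionIntegrand T f x ∂η)
      + (∫ x, jumpU π f x ∂η) - (∫ x, divVIntegrand π f x ∂η)
      + (∫ x, hessWIntegrand π f x ∂η) = 0

end Functionals

end

end LevyTypeInvariant

namespace LevyTypeInvariant

noncomputable section

/-! ### Integration against integrated radial tails -/

/-! Two facts are combined. The analytic one is the pointwise identity `op_eq_integrands`: for a
test function `f`, `T.op f x` is the signed sum of the five integrands of the distributional
equation. It comes from the fundamental theorem of calculus along rays. Integrating the radial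
derivative of `φ` against `radialTail P` gives `∫ (φ y - φ 0) dP` (`integral_radialTail_fderiv`).
One application turns the `μ`-term into first differences of `f`, two turn the `ρ`-term into
first-order Taylor remainders, and `aπ` accounts exactly for the mismatch with the truncation at
`|y| < 1`. Since all five integrands are `η`-integrable, `η` solves the equation iff `∫ 𝒜f dη = 0`
for every test function `f` (`solvesDistributionalEquation_iff`).

The probabilistic one is that invariance of a finite measure is infinitesimal. If `η` is invariant,
the difference quotients of `t ↦ ∫ P_t f dη` vanish, hence so does their limit `∫ 𝒜f dη`.
Conversely, a function `P_t f` need not be a test function, so the core is needed: `g ↦ ∫ g dη` is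
sup-norm continuous, so the identity `∫ 𝒜g dη = 0` passes from the core to the whole domain
(`integral_eq_zero_of_hasCore`). The semigroup preserves the domain and commutes with `𝒜`, so `t ↦ ∫
P_t f dη` is continuous with right derivative `∫ 𝒜P_t f dη = 0`, hence constant
(`IsFeller.integral_semigroup_eq`). Test functions separate finite measures
(`measure_ext_of_testFn`), which gives invariance. -/

instance Triplet.sFinite_Pi {d : ℕ} (T : Triplet d) (x : Rd d) : SFinite (T.Pi x) := by
  have hm : Measurable fun y : Rd d => ENNReal.ofReal (min 1 (‖y‖ ^ 2)) := by fun_prop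
  have hfin : IsFiniteMeasure ((T.Pi x).withDensity fun y => ENNReal.ofReal (min 1 (‖y‖ ^ 2))) :=
    isFiniteMeasure_withDensity (T.levy x).ne
  have h0 : ∀ᵐ y ∂(T.Pi x), ENNReal.ofReal (min 1 (‖y‖ ^ 2)) ≠ 0 := by
    have : ∀ᵐ y ∂(T.Pi x), y ≠ 0 := by
      rw [ae_iff]
      simpa only [not_not, ofPred_eq_eq_singleton] using T.Pi_zero x
    filter_upwards [this] with y hy
    simp [hy]
  -- The Lévy measure is recovered from a finite measure by dividing out the density, which vanishes
  -- only at the null point `0`.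
  rw [← withDensity_inv_same hm h0 (Eventually.of_forall fun _ => ENNReal.ofReal_ne_top)]
  infer_instance

instance sFinite_weighted {d : ℕ} (h : Rd d → ℝ) (P : Measure (Rd d)) [SFinite P] :
    SFinite (weighted h P) := by
  unfold weighted; infer_instance

instance sFinite_radialTail {d : ℕ} (P : Measure (Rd d)) [SFinite P] :
    SFinite (radialTail P) := by
  unfold radialTail; infer_instance

/-- Fubini on the region under the graph of the norm; this is where s-finiteness of `P` enters. -/
theorem integral_radialTail {d : ℕ} {P : Measure (Rd d)} [SFinite P] {F : Rd d → ℝ}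
    (hF : Integrable F (radialTail P)) :
    Integrable (fun y => ∫ z in Ioo 0 ‖y‖, F (z • (‖y‖⁻¹ • y))) P ∧
      ∫ u, F u ∂(radialTail P) = ∫ y, (∫ z in Ioo 0 ‖y‖, F (z • (‖y‖⁻¹ • y))) ∂P := by
  have hS : MeasurableSet {p : Rd d × ℝ | 0 < p.2 ∧ p.2 < ‖p.1‖} :=
    (measurableSet_lt measurable_const measurable_snd).inter
      (measurableSet_lt measurable_snd measurable_fst.norm)
  have hi : Integrable ({p : Rd d × ℝ | 0 < p.2 ∧ p.2 < ‖p.1‖}.indicator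
      fun p => F (p.2 • (‖p.1‖⁻¹ • p.1))) (P.prod volume) := by
    rw [integrable_indicator_iff hS]
    exact hF.comp_measurable (measurable_radial d)
  have he : ∀ y : Rd d, ∫ z : ℝ, {p : Rd d × ℝ | 0 < p.2 ∧ p.2 < ‖p.1‖}.indicator
      (fun p => F (p.2 • (‖p.1‖⁻¹ • p.1))) (y, z) =
        ∫ z in Ioo 0 ‖y‖, F (z • (‖y‖⁻¹ • y)) := by
    intro y
    rw [← integral_indicator measurableSet_Ioo]
    rfl
  refine ⟨by simpa only [he] using hi.integral_prod_left, ?_⟩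
  rw [radialTail, integral_map (measurable_radial d).aemeasurable hF.aestronglyMeasurable,
    ← integral_indicator hS, integral_prod _ hi]
  simp only [he]

theorem setIntegral_Ioo_eq_sub {g g' : ℝ → ℝ} (hg : ∀ t, HasDerivAt g (g' t) t)
    (hg' : Continuous g') {r : ℝ} (hr : 0 ≤ r) : ∫ z in Ioo 0 r, g' z = g r - g 0 := by
  rw [← integral_Ioc_eq_integral_Ioo, ← intervalIntegral.integral_of_le hr]
  exact intervalIntegral.integral_eq_sub_of_hasDerivAt (fun t _ => hg t)
    (hg'.intervalIntegrable _ _)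

theorem normalize_smul_normalize {d : ℕ} {y : Rd d} {z : ℝ} (hz : z ∈ Ioo 0 ‖y‖) :
    ‖z • (‖y‖⁻¹ • y)‖⁻¹ • (z • (‖y‖⁻¹ • y)) = ‖y‖⁻¹ • y := by
  have hy : ‖y‖ ≠ 0 := (hz.1.trans hz.2).ne'
  have hz0 : z ≠ 0 := hz.1.ne'
  rw [norm_smul, norm_smul, norm_inv, norm_norm, inv_mul_cancel₀ hy, mul_one,
    Real.norm_of_nonneg hz.1.le, smul_smul, inv_mul_cancel₀ hz0, one_smul]

theorem norm_smul_normalize {d : ℕ} (y : Rd d) : ‖y‖ • (‖y‖⁻¹ • y) = y := by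
  rcases eq_or_ne y 0 with rfl | hy
  · simp
  · rw [smul_smul, mul_inv_cancel₀ (norm_ne_zero_iff.2 hy), one_smul]

/-- On the ray through `y` the unit direction is constant, so the inner integral is that of the
derivative of `t ↦ φ (t • y/|y|)` over `(0, |y|)`. At `y = 0` both sides of `he` vanish, the
interval being empty. -/
theorem integral_radialTail_fderiv {d : ℕ} {P : Measure (Rd d)} [SFinite P] {φ : Rd d → ℝ}
    (hφ : ContDiff ℝ 1 φ)
    (hi : Integrable (fun u => fderiv ℝ φ u (‖u‖⁻¹ • u)) (radialTail P)) :
    Integrable (fun y => φ y - φ 0) P ∧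
      ∫ u, fderiv ℝ φ u (‖u‖⁻¹ • u) ∂(radialTail P) = ∫ y, (φ y - φ 0) ∂P := by
  have he : ∀ y : Rd d, ∫ z in Ioo 0 ‖y‖, fderiv ℝ φ (z • (‖y‖⁻¹ • y))
      (‖z • (‖y‖⁻¹ • y)‖⁻¹ • (z • (‖y‖⁻¹ • y))) = φ y - φ 0 := by
    intro y
    have h1 : ∀ t : ℝ, HasDerivAt (fun t : ℝ => φ (t • (‖y‖⁻¹ • y)))
        (fderiv ℝ φ (t • (‖y‖⁻¹ • y)) (‖y‖⁻¹ • y)) t := by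
      intro t
      have h2 : HasDerivAt (fun t : ℝ => t • (‖y‖⁻¹ • y)) (‖y‖⁻¹ • y) t := by
        simpa using (hasDerivAt_id t).smul_const (‖y‖⁻¹ • y)
      exact ((hφ.differentiable one_ne_zero).differentiableAt.hasFDerivAt.comp_hasDerivAt t h2)
    have h3 : Continuous fun t : ℝ => fderiv ℝ φ (t • (‖y‖⁻¹ • y)) (‖y‖⁻¹ • y) :=
      ((hφ.continuous_fderiv one_ne_zero).comp (by fun_prop)).clm_apply continuous_const
    have h4 := setIntegral_Ioo_eq_sub h1 h3 (norm_nonneg y)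
    rw [norm_smul_normalize, zero_smul] at h4
    rw [← h4]
    refine setIntegral_congr_fun measurableSet_Ioo fun z hz => ?_
    simp only [normalize_smul_normalize hz]
  have := integral_radialTail hi
  simpa only [he] using this

/-! ### Local finiteness of the integrated radial tails. -/

theorem volume_Ioo_inter_closedBall_le {d : ℕ} (y : Rd d) (R : ℝ) :
    ∫⁻ z in Ioo 0 ‖y‖, (Metric.closedBall (0 : Rd d) R).indicator 1 (z • (‖y‖⁻¹ • y)) ≤
      ENNReal.ofReal (min ‖y‖ R) := by
  calc ∫⁻ z in Ioo 0 ‖y‖, (Metric.closedBall (0 : Rd d) R).indicator 1 (z • (‖y‖⁻¹ • y))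
      ≤ ∫⁻ z, (Icc 0 (min ‖y‖ R)).indicator 1 z := by
        rw [← lintegral_indicator measurableSet_Ioo]
        refine lintegral_mono fun z => ?_
        by_cases hz : z ∈ Ioo 0 ‖y‖
        · rw [indicator_of_mem hz]
          by_cases hR : z • (‖y‖⁻¹ • y) ∈ Metric.closedBall (0 : Rd d) R
          · have hy : ‖y‖ ≠ 0 := (hz.1.trans hz.2).ne'
            rw [mem_closedBall_zero_iff, norm_smul, norm_smul, norm_inv, norm_norm,
              inv_mul_cancel₀ hy, mul_one, Real.norm_of_nonneg hz.1.le] at hR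
            rw [indicator_of_mem (show z ∈ Icc 0 (min ‖y‖ R) from ⟨hz.1.le, le_min hz.2.le hR⟩)]
            exact indicator_le_self' (fun _ _ => zero_le) _
          · rw [indicator_of_notMem hR]
            exact zero_le
        · rw [indicator_of_notMem hz]
          exact zero_le
    _ = ENNReal.ofReal (min ‖y‖ R) := by
        rw [lintegral_indicator_one measurableSet_Icc, Real.volume_Icc, sub_zero]

theorem radialTail_closedBall_le {d : ℕ} (P : Measure (Rd d)) (R : ℝ) :
    radialTail P (Metric.closedBall 0 R) ≤ ∫⁻ y, ENNReal.ofReal (min ‖y‖ R) ∂P := by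
  rw [← lintegral_indicator_one Metric.isClosed_closedBall.measurableSet,
    lintegral_radialTail _ (measurable_one.indicator Metric.isClosed_closedBall.measurableSet)]
  exact lintegral_mono fun y => volume_Ioo_inter_closedBall_le y R

/-- Each point of the segment from `0` to `y` contributes at most `min ‖y‖ R`, and the segment has
length `‖y‖`. -/
theorem doubleRadialTail_closedBall_le {d : ℕ} (P : Measure (Rd d)) (R : ℝ) :
    doubleRadialTail P (Metric.closedBall 0 R) ≤
      ∫⁻ y, ENNReal.ofReal (‖y‖ * min ‖y‖ R) ∂P := by
  refine (radialTail_closedBall_le _ R).trans ?_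
  rw [lintegral_radialTail P (by fun_prop)]
  refine lintegral_mono fun y => ?_
  calc ∫⁻ z in Ioo 0 ‖y‖, ENNReal.ofReal (min ‖z • (‖y‖⁻¹ • y)‖ R)
      ≤ ∫⁻ z in Ioo 0 ‖y‖, ENNReal.ofReal (min ‖y‖ R) := by
        refine setLIntegral_mono' measurableSet_Ioo fun z hz => ?_
        have hy : ‖y‖ ≠ 0 := (hz.1.trans hz.2).ne'
        rw [norm_smul, norm_smul, norm_inv, norm_norm, inv_mul_cancel₀ hy, mul_one,
          Real.norm_of_nonneg hz.1.le]
        exact ENNReal.ofReal_le_ofReal (min_le_min_right _ hz.2.le)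
    _ = ENNReal.ofReal (‖y‖ * min ‖y‖ R) := by
        rw [setLIntegral_const, Real.volume_Ioo, sub_zero, mul_comm,
          ENNReal.ofReal_mul (norm_nonneg y)]

theorem min_le_max_one_mul_min {r R : ℝ} (hr : 0 ≤ r) : min r R ≤ max 1 R * min 1 r := by
  have h1 : (1 : ℝ) ≤ max 1 R := le_max_left _ _
  rcases le_total 1 r with h | h
  · rw [min_eq_left h, mul_one]
    exact (min_le_right _ _).trans (le_max_right _ _)
  · rw [min_eq_right h]
    exact (min_le_left _ _).trans (le_mul_of_one_le_left hr h1)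

theorem isFiniteMeasureOnCompacts_of_closedBall {d : ℕ} {M : Measure (Rd d)}
    (hM : ∀ R, M (Metric.closedBall 0 R) < ⊤) : IsFiniteMeasureOnCompacts M := by
  refine ⟨fun K hK => ?_⟩
  obtain ⟨R, hR⟩ := hK.isBounded.subset_closedBall 0
  exact (measure_mono hR).trans_lt (hM R)

/-- Makes translates of compactly supported continuous functions integrable against the tail, so
that `integral_radialTail` applies to derivatives of test functions. -/
theorem isFiniteMeasureOnCompacts_radialTail {d : ℕ} {P : Measure (Rd d)}
    (hP : ∫⁻ y, ENNReal.ofReal (min 1 ‖y‖) ∂P < ⊤) : IsFiniteMeasureOnCompacts (radialTail P) := by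
  refine isFiniteMeasureOnCompacts_of_closedBall fun R => ?_
  refine (radialTail_closedBall_le P R).trans_lt ?_
  calc ∫⁻ y, ENNReal.ofReal (min ‖y‖ R) ∂P
      ≤ ∫⁻ y, ENNReal.ofReal (max 1 R) * ENNReal.ofReal (min 1 ‖y‖) ∂P := by
        refine lintegral_mono fun y => ?_
        rw [← ENNReal.ofReal_mul (zero_le_one.trans (le_max_left _ _))]
        exact ENNReal.ofReal_le_ofReal (min_le_max_one_mul_min (norm_nonneg y))
    _ = ENNReal.ofReal (max 1 R) * ∫⁻ y, ENNReal.ofReal (min 1 ‖y‖) ∂P :=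
        lintegral_const_mul _ (by fun_prop)
    _ < ⊤ := ENNReal.mul_lt_top ENNReal.ofReal_lt_top hP

theorem isFiniteMeasureOnCompacts_doubleRadialTail {d : ℕ} {P : Measure (Rd d)}
    (hP : ∫⁻ y, ENNReal.ofReal (min ‖y‖ (‖y‖ ^ 2)) ∂P < ⊤) :
    IsFiniteMeasureOnCompacts (doubleRadialTail P) := by
  refine isFiniteMeasureOnCompacts_of_closedBall fun R => ?_
  refine (doubleRadialTail_closedBall_le P R).trans_lt ?_
  calc ∫⁻ y, ENNReal.ofReal (‖y‖ * min ‖y‖ R) ∂P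
      ≤ ∫⁻ y, ENNReal.ofReal (max 1 R) * ENNReal.ofReal (min ‖y‖ (‖y‖ ^ 2)) ∂P := by
        refine lintegral_mono fun y => ?_
        rw [← ENNReal.ofReal_mul (zero_le_one.trans (le_max_left _ _))]
        refine ENNReal.ofReal_le_ofReal ?_
        calc ‖y‖ * min ‖y‖ R ≤ ‖y‖ * (max 1 R * min 1 ‖y‖) :=
              mul_le_mul_of_nonneg_left (min_le_max_one_mul_min (norm_nonneg y)) (norm_nonneg y)
          _ = max 1 R * (‖y‖ * min 1 ‖y‖) := by ring
          _ = max 1 R * min ‖y‖ (‖y‖ ^ 2) := by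
              rw [mul_min_of_nonneg _ _ (norm_nonneg y), mul_one, pow_two]
    _ = ENNReal.ofReal (max 1 R) * ∫⁻ y, ENNReal.ofReal (min ‖y‖ (‖y‖ ^ 2)) ∂P :=
        lintegral_const_mul _ (by fun_prop)
    _ < ⊤ := ENNReal.mul_lt_top ENNReal.ofReal_lt_top hP

theorem integrable_translate {d : ℕ} {M : Measure (Rd d)} [IsFiniteMeasureOnCompacts M]
    {k : Rd d → ℝ} (hk : Continuous k) (hc : HasCompactSupport k) (x : Rd d) :
    Integrable (fun u => k (x + u)) M :=
  (hk.comp (continuous_const_add x)).integrable_of_hasCompactSupport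
    (hc.comp_homeomorph (Homeomorph.addLeft x))

theorem integrable_translate_mul {d : ℕ} {M : Measure (Rd d)} [IsFiniteMeasureOnCompacts M]
    {k : Rd d → ℝ} (hk : Continuous k) (hc : HasCompactSupport k) (x : Rd d) {q : Rd d → ℝ}
    (hq : Measurable q) (hq1 : ∀ u, |q u| ≤ 1) : Integrable (fun u => k (x + u) * q u) M :=
  (integrable_translate hk hc x).mul_bdd (c := 1) hq.aestronglyMeasurable
    (Eventually.of_forall hq1)

/-! ### Partial derivatives of smooth functions -/

theorem sum_apply_basisVec {d : ℕ} (L : Rd d →L[ℝ] ℝ) (v : Rd d) :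
    ∑ i, L (basisVec i) * v i = L v := by
  conv_rhs => rw [← (EuclideanSpace.basisFun (Fin d) ℝ).sum_repr v]
  simp [map_sum, mul_comm]

theorem contDiff_pderiv {d : ℕ} {f : Rd d → ℝ} (hf : ContDiff ℝ ((⊤ : ℕ∞) : WithTop ℕ∞) f)
    (i : Fin d) : ContDiff ℝ ((⊤ : ℕ∞) : WithTop ℕ∞) (pderiv i f) :=
  (hf.fderiv_right (m := ((⊤ : ℕ∞) : WithTop ℕ∞)) (by simp)).clm_apply contDiff_const

theorem hasCompactSupport_pderiv {d : ℕ} {f : Rd d → ℝ} (hf : HasCompactSupport f) (i : Fin d) :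
    HasCompactSupport (pderiv i f) :=
  (hf.fderiv (𝕜 := ℝ)).comp_left (g := fun L : Rd d →L[ℝ] ℝ => L (basisVec i)) rfl

theorem abs_div_norm_le_one {d : ℕ} (u : Rd d) (i : Fin d) : |u i / ‖u‖| ≤ 1 := by
  rw [abs_div, abs_norm]
  exact div_le_one_of_le₀ (PiLp.norm_apply_le u i) (norm_nonneg u)

theorem sum_pderiv_mul_div_norm {d : ℕ} (f : Rd d → ℝ) (x u : Rd d) :
    ∑ i, pderiv i f x * (u i / ‖u‖) = fderiv ℝ f x (‖u‖⁻¹ • u) := by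
  rw [← sum_apply_basisVec]
  refine Finset.sum_congr rfl fun i _ => ?_
  simp [pderiv, div_eq_inv_mul]

/-! ### The jump functionals as integrals against the Lévy kernel -/

section Jumps

variable {d : ℕ} {T : Triplet d} (π : ConvenientDecomposition T.Pi) (f : TestFn d) (x : Rd d)

instance sFinite_ν : SFinite (π.ν x) := sFinite_weighted _ _
instance sFinite_μ : SFinite (π.μ x) := sFinite_weighted _ _
instance sFinite_ρ : SFinite (π.ρ x) := sFinite_weighted _ _
instance isFiniteMeasure_ν : IsFiniteMeasure (π.ν x) := ⟨π.finite_ν x⟩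

theorem jumpU_eq : Integrable (fun y => f (x + y) - f x) (π.ν x) ∧
    jumpU π f x = ∫ y, (f (x + y) - f x) ∂(π.ν x) := by
  have h := integrable_translate (M := π.ν x) f.continuous f.hasCompactSupport x
  refine ⟨h.sub (integrable_const _), ?_⟩
  rw [integral_sub h (integrable_const _), integral_const, jumpU, smul_eq_mul, mul_comm]

theorem sum_jumpV_eq : Integrable (fun y => f (x + y) - f x) (π.μ x) ∧
    ∑ i, jumpV π i (pderiv i f) x = ∫ y, (f (x + y) - f x) ∂(π.μ x) := by
  have := isFiniteMeasureOnCompacts_radialTail (P := π.μ x) (π.finite_μ x)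
  have hi : ∀ i, Integrable (fun u => pderiv i f (x + u) * (u i / ‖u‖)) (radialTail (π.μ x)) :=
    fun i => integrable_translate_mul (contDiff_pderiv f.contDiff i).continuous
      (hasCompactSupport_pderiv f.hasCompactSupport i) x (by fun_prop)
      fun u => abs_div_norm_le_one u i
  have hd : ∀ u, fderiv ℝ (fun u => f (x + u)) u = fderiv ℝ f (x + u) := fun u => by
    rw [fderiv_comp_add_left]
  have hs := integrable_finsetSum Finset.univ fun i _ => hi i
  have hφ : ContDiff ℝ 1 fun u => f (x + u) :=
    (f.contDiff.of_le (by exact_mod_cast le_top)).comp (contDiff_const.add contDiff_id)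
  -- Apply the ray formula to `u ↦ f (x + u)`, whose radial derivative is the sum of the integrands
  -- of the `jumpV π i (pderiv i f) x`.
  have key := integral_radialTail_fderiv (P := π.μ x) hφ (by
    simpa only [hd, sum_pderiv_mul_div_norm] using hs)
  simp only [add_zero] at key
  refine ⟨key.1, ?_⟩
  rw [← key.2]
  simp only [jumpV]
  rw [← integral_finsetSum _ fun i _ => hi i]
  simp only [hd, sum_pderiv_mul_div_norm]

/-- The outer tail integrates the Hessian in direction `e = w/|w|` to `(∇f(x + w) - ∇f(x)) · e`.
This is the radial derivative of `u ↦ f(x + u) - ∇f(x) · u`, so the remaining tail yields the Taylor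
remainder. -/
theorem sum_jumpW_eq :
    Integrable (fun y => f (x + y) - f x - fderiv ℝ f x y) (π.ρ x) ∧
      ∑ i, ∑ j, jumpW π i j (pderiv i (pderiv j f)) x =
        ∫ y, (f (x + y) - f x - fderiv ℝ f x y) ∂(π.ρ x) := by
  have := isFiniteMeasureOnCompacts_doubleRadialTail (P := π.ρ x) (π.finite_ρ x)
  have hi : ∀ i j, Integrable (fun u => pderiv i (pderiv j f) (x + u) * (u i * u j / ‖u‖ ^ 2))
      (doubleRadialTail (π.ρ x)) := fun i j =>
    integrable_translate_mul (contDiff_pderiv (contDiff_pderiv f.contDiff j) i).continuous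
      (hasCompactSupport_pderiv (hasCompactSupport_pderiv f.hasCompactSupport j) i) x
      (by fun_prop) fun u => by
        rw [pow_two, mul_div_mul_comm, abs_mul]
        exact mul_le_one₀ (abs_div_norm_le_one u i) (abs_nonneg _) (abs_div_norm_le_one u j)
  have hs := integrable_finsetSum Finset.univ fun i _ =>
    integrable_finsetSum Finset.univ fun j _ => hi i j
  have he : ∀ w : Rd d, ∫ z in Ioo 0 ‖w‖, (∑ i, ∑ j,
      pderiv i (pderiv j f) (x + z • (‖w‖⁻¹ • w)) * ((z • (‖w‖⁻¹ • w)) i *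
        (z • (‖w‖⁻¹ • w)) j / ‖z • (‖w‖⁻¹ • w)‖ ^ 2)) =
      (fderiv ℝ f (x + w) - fderiv ℝ f x) (‖w‖⁻¹ • w) := by
    intro w
    set e := ‖w‖⁻¹ • w with he
    have h1 : ∀ t : ℝ, HasDerivAt (fun t : ℝ => ∑ j, pderiv j f (x + t • e) * e j)
        (∑ j, fderiv ℝ (pderiv j f) (x + t • e) e * e j) t := by
      intro t
      refine HasDerivAt.fun_sum fun j _ => ?_
      have h2 : HasDerivAt (fun t : ℝ => x + t • e) e t := by
        simpa using ((hasDerivAt_id t).smul_const e).const_add x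
      exact ((((contDiff_pderiv f.contDiff j).differentiable
        (by simp)).differentiableAt.hasFDerivAt.comp_hasDerivAt t h2)).mul_const _
    have h3 : Continuous fun t : ℝ => ∑ j, fderiv ℝ (pderiv j f) (x + t • e) e * e j := by
      refine continuous_finsetSum _ fun j _ => Continuous.mul ?_ continuous_const
      exact (((contDiff_pderiv f.contDiff j).continuous_fderiv (by simp)).comp
        (by fun_prop)).clm_apply continuous_const
    have h4 := setIntegral_Ioo_eq_sub h1 h3 (norm_nonneg w)
    have h5 : ∀ v, ∑ j, pderiv j f v * e j = fderiv ℝ f v e := fun v => sum_apply_basisVec _ _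
    simp only [h5] at h4
    rw [he, norm_smul_normalize, zero_smul, add_zero, ← he] at h4
    rw [sub_apply, ← h4]
    refine setIntegral_congr_fun measurableSet_Ioo fun z hz => ?_
    have hn : ∀ i, (z • e) i / ‖z • e‖ = e i := fun i => by
      have := congrArg (fun v : Rd d => v i) (normalize_smul_normalize hz)
      rw [← he] at this
      simpa [div_eq_inv_mul] using this
    simp only [pow_two, mul_div_mul_comm, hn]
    rw [Finset.sum_comm]
    refine Finset.sum_congr rfl fun j _ => ?_
    rw [← sum_apply_basisVec (fderiv ℝ (pderiv j f) (x + z • e)), Finset.sum_mul]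
    exact Finset.sum_congr rfl fun i _ => (mul_assoc _ _ _).symm
  have key1 := integral_radialTail (P := radialTail (π.ρ x)) hs
  simp only [he] at key1
  have hf1 : Differentiable ℝ f := f.contDiff.differentiable (by simp)
  have hφ : ContDiff ℝ 1 fun u => f (x + u) - fderiv ℝ f x u :=
    ((f.contDiff.of_le (by exact_mod_cast le_top)).comp (contDiff_const.add contDiff_id)).sub
      (fderiv ℝ f x).contDiff
  have hd : ∀ u, fderiv ℝ (fun u => f (x + u) - fderiv ℝ f x u) u =
      fderiv ℝ f (x + u) - fderiv ℝ f x := fun u => by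
    have h1 : HasFDerivAt (fun u => f (x + u)) (fderiv ℝ f (x + u)) u := by
      have h2 := (hf1 (x + u)).hasFDerivAt.comp u ((hasFDerivAt_id u).const_add x)
      rwa [ContinuousLinearMap.comp_id] at h2
    exact (h1.sub (fderiv ℝ f x).hasFDerivAt).fderiv
  -- The integrability required for this second application is the Fubini by-product `key1.1` of the
  -- first.
  have key2 := integral_radialTail_fderiv (P := π.ρ x) hφ (by simpa only [hd] using key1.1)
  have hr : ∀ y, f (x + y) - fderiv ℝ f x y - (f (x + 0) - fderiv ℝ f x 0) =
      f (x + y) - f x - fderiv ℝ f x y := fun y => by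
    rw [add_zero, map_zero]; ring
  simp only [hr, hd] at key2
  refine ⟨key2.1, ?_⟩
  rw [← key2.2, ← key1.2]
  simp only [jumpW]
  rw [← doubleRadialTail, integral_finsetSum _ fun i _ =>
    integrable_finsetSum Finset.univ fun j _ => hi i j]
  refine Finset.sum_congr rfl fun i _ => ?_
  rw [integral_finsetSum _ fun j _ => hi i j]

theorem integrableOn_id_of_norm_le {M : Measure (Rd d)} {s : Set (Rd d)} (hs : MeasurableSet s)
    {g : Rd d → ℝ} (hfin : ∫⁻ y, ENNReal.ofReal (g y) ∂M < ⊤)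
    (h : ∀ y ∈ s, ‖y‖ ≤ g y) : IntegrableOn (fun y => y) s M := by
  refine ⟨measurable_id.aestronglyMeasurable, ?_⟩
  refine lt_of_le_of_lt ?_ hfin
  calc ∫⁻ y in s, ‖y‖ₑ ∂M ≤ ∫⁻ y in s, ENNReal.ofReal (g y) ∂M := by
        refine setLIntegral_mono' hs fun y hy => ?_
        rw [← ofReal_norm]
        exact ENNReal.ofReal_le_ofReal (h y hy)
    _ ≤ ∫⁻ y, ENNReal.ofReal (g y) ∂M := setLIntegral_le_lintegral _ _

theorem integrableOn_ball_ν : IntegrableOn (fun y => y) (Metric.ball 0 1) (π.ν x) := by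
  refine integrableOn_id_of_norm_le measurableSet_ball (g := fun _ => 1) ?_
    fun y hy => (mem_ball_zero_iff.1 hy).le
  simp

theorem integrableOn_ball_μ : IntegrableOn (fun y => y) (Metric.ball 0 1) (π.μ x) :=
  integrableOn_id_of_norm_le measurableSet_ball (g := fun y => min 1 ‖y‖)
    (π.finite_μ x) fun _ hy => le_min (mem_ball_zero_iff.1 hy).le le_rfl

theorem integrableOn_compl_ball_ρ : IntegrableOn (fun y => y) (Metric.ball 0 1)ᶜ (π.ρ x) := by
  refine integrableOn_id_of_norm_le measurableSet_ball.compl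
    (g := fun y => min ‖y‖ (‖y‖ ^ 2)) (π.finite_ρ x) fun y hy => le_min le_rfl ?_
  rw [mem_compl_iff, mem_ball_zero_iff, not_lt] at hy
  exact le_self_pow₀ hy two_ne_zero

theorem integral_indicator_clm {M : Measure (Rd d)} {s : Set (Rd d)} (hs : MeasurableSet s)
    (h : IntegrableOn (fun y => y) s M) (L : Rd d →L[ℝ] ℝ) :
    Integrable (s.indicator L) M ∧ ∫ y, s.indicator L y ∂M = L (∫ y in s, y ∂M) := by
  refine ⟨(integrable_indicator_iff hs).2 (L.integrable_comp h), ?_⟩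
  rw [integral_indicator hs]
  exact L.integral_comp_comm h

/-- The Lévy-type operator in terms of the integrands of the distributional equation. -/
theorem op_eq_integrands : T.op f x = - driftIntegrand T π f x + diffusionIntegrand T f x +
    jumpU π f x - divVIntegrand π f x + hessWIntegrand π f x := by
  obtain ⟨iU, eU⟩ := jumpU_eq π f x
  obtain ⟨iV, eV⟩ := sum_jumpV_eq π f x
  obtain ⟨iW, eW⟩ := sum_jumpW_eq π f x
  set L := fderiv ℝ f x with hL
  have hp : ∀ v : Rd d, ∑ i, pderiv i f x * v i = L v := fun v => sum_apply_basisVec _ _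
  have hp' : ∀ v : Rd d, ∑ i, v i * pderiv i f x = L v := fun v => by
    rw [← hp]; exact Finset.sum_congr rfl fun i _ => mul_comm _ _
  obtain ⟨jν, fν⟩ := integral_indicator_clm measurableSet_ball (integrableOn_ball_ν π x) L
  obtain ⟨jμ, fμ⟩ := integral_indicator_clm measurableSet_ball (integrableOn_ball_μ π x) L
  obtain ⟨jρ, fρ⟩ := integral_indicator_clm measurableSet_ball.compl
    (integrableOn_compl_ball_ρ π x) L
  -- The `ρ`-part is compensated for all `y`, the operator only for `|y| < 1`; the excess over `|y|
  -- ≥ 1` becomes the last term of `aπ`.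
  have hρ : ∀ y, f (x + y) - f x - (Metric.ball (0 : Rd d) 1).indicator L y =
      (f (x + y) - f x - L y) + (Metric.ball (0 : Rd d) 1)ᶜ.indicator L y := fun y => by
    have := congrFun (indicator_self_add_compl (Metric.ball (0 : Rd d) 1) L) y
    simp only [Pi.add_apply] at this
    rw [← this]; ring
  have kρ : Integrable (fun y => f (x + y) - f x - (Metric.ball (0 : Rd d) 1).indicator L y)
      (π.ρ x) := by
    simp only [hρ]
    exact iW.add jρ
  have hsum : T.Pi x = π.ν x + π.μ x + π.ρ x := π.sum_eq x
  have hint : ∫ y, (f (x + y) - f x - (Metric.ball (0 : Rd d) 1).indicator L y) ∂(T.Pi x) =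
      jumpU π f x + ∑ i, jumpV π i (pderiv i f) x +
        ∑ i, ∑ j, jumpW π i j (pderiv i (pderiv j f)) x + L (π.aπ x) := by
    have kν : Integrable (fun y => f (x + y) - f x - (Metric.ball (0 : Rd d) 1).indicator L y)
      (π.ν x) := iU.sub jν
    have kμ : Integrable (fun y => f (x + y) - f x - (Metric.ball (0 : Rd d) 1).indicator L y)
      (π.μ x) := iV.sub jμ
    rw [hsum, integral_add_measure (kν.add_measure kμ) kρ, integral_add_measure kν kμ,
      integral_sub iU jν, integral_sub iV jμ]
    simp only [hρ]
    rw [integral_add iW jρ, eU, eV, eW, fν, fμ, fρ, ConvenientDecomposition.aπ, map_add, map_sub,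
      map_neg]
    ring
  have hfun : (fun z : Rd d => ∑ i, pderiv i f x * z i) = L := funext hp
  rw [Triplet.op, hfun, hint, driftIntegrand, diffusionIntegrand, divVIntegrand, hessWIntegrand,
    hp', hp', map_add]
  ring

end Jumps

/-! ### The transition semigroup of a Markov process -/

section Markov

variable {E Ω : Type*} [MeasurableSpace E] [MeasurableSpace Ω] (X : MarkovProcess E Ω)

instance MarkovProcess.instIsMarkovKernelLaw : IsMarkovKernel X.law := X.isMarkovKernel_law

instance MarkovProcess.instIsMarkovKernelTransition (t : ℝ≥0) :
    IsMarkovKernel (X.transition t) :=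
  Kernel.IsMarkovKernel.map X.law (X.measurable_X t)

theorem MarkovProcess.transition_apply' (t : ℝ≥0) (x : E) {B : Set E} (hB : MeasurableSet B) :
    X.transition t x B = X.law x (X.X t ⁻¹' B) :=
  Kernel.map_apply' _ (X.measurable_X t) _ hB

theorem MarkovProcess.integral_transition (t : ℝ≥0) {f : E → ℝ} (hf : StronglyMeasurable f)
    (x : E) : ∫ y, f y ∂(X.transition t x) = X.semigroup t f x := by
  rw [transition, Kernel.map_apply _ (X.measurable_X t),
    integral_map (X.measurable_X t).aemeasurable hf.aestronglyMeasurable, semigroup]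

/-- The Chapman-Kolmogorov equations. -/
theorem MarkovProcess.transition_add (s t : ℝ≥0) :
    X.transition (s + t) = X.transition t ∘ₖ X.transition s := by
  ext x B hB
  have hm : ⨆ u : Iic s, MeasurableSpace.comap (X.X u) inferInstance ≤ ‹MeasurableSpace Ω› :=
    iSup_le fun u => (X.measurable_X u).comap_le
  have hB' : MeasurableSet (X.X (s + t) ⁻¹' B) := X.measurable_X _ hB
  have hk : Measurable fun y => X.transition t y B := Kernel.measurable_coe _ hB
  have h := integral_congr_ae (X.markov x s t B hB)
  rw [integral_condExp hm, integral_indicator_const _ hB', smul_eq_mul, mul_one] at h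
  have hr : ∫ ω, (X.law (X.X s ω)).real (X.X t ⁻¹' B) ∂(X.law x) =
      (∫⁻ ω, X.transition t (X.X s ω) B ∂(X.law x)).toReal := by
    simp only [Measure.real, ← X.transition_apply' t _ hB]
    exact integral_toReal (hk.comp (X.measurable_X s)).aemeasurable
      (Eventually.of_forall fun ω => measure_lt_top _ _)
  have hfin : ∫⁻ ω, X.transition t (X.X s ω) B ∂(X.law x) ≠ ⊤ := by
    refine ne_top_of_le_ne_top ENNReal.one_ne_top ?_
    calc ∫⁻ ω, X.transition t (X.X s ω) B ∂(X.law x) ≤ ∫⁻ _, 1 ∂(X.law x) :=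
          lintegral_mono fun ω => prob_le_one
      _ = 1 := by simp
  rw [hr, Measure.real, ENNReal.toReal_eq_toReal_iff' (measure_ne_top _ _) hfin] at h
  rw [Kernel.comp_apply' _ _ _ hB, X.transition_apply' _ _ hB, h]
  conv_rhs => rw [MarkovProcess.transition, Kernel.map_apply _ (X.measurable_X s)]
  rw [lintegral_map hk (X.measurable_X s)]

theorem MarkovProcess.abs_semigroup_le (t : ℝ≥0) {g : E → ℝ} {c : ℝ} (hg : ∀ y, |g y| ≤ c)
    (x : E) : |X.semigroup t g x| ≤ c := by
  have := norm_integral_le_of_norm_le_const (μ := X.law x) (f := fun ω => g (X.X t ω)) (C := c)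
    (Eventually.of_forall fun ω => hg _)
  simpa [MarkovProcess.semigroup] using this

end Markov

/-! ### The Feller semigroup and its generator tested against a finite measure. -/

section Feller

variable {d : ℕ} {Ω : Type*} [MeasurableSpace Ω] {X : MarkovProcess (Rd d) Ω}

theorem stronglyMeasurable_C0 (f : C₀(Rd d, ℝ)) : StronglyMeasurable f :=
  (map_continuous f).stronglyMeasurable

theorem integrable_C0_of_isFiniteMeasure (f : C₀(Rd d, ℝ)) (η : Measure (Rd d))
    [IsFiniteMeasure η] : Integrable f η :=
  Integrable.of_bound (C := ‖f‖) (stronglyMeasurable_C0 f).aestronglyMeasurable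
    (Eventually.of_forall fun x => f.toBCF.norm_coe_le_norm x)

theorem integral_sub_sub_div {α : Type*} [MeasurableSpace α] {m : Measure α} {u v w : α → ℝ}
    (hu : Integrable u m) (hv : Integrable v m) (hw : Integrable w m) (r : ℝ) :
    ∫ a, (u a - (v a - w a) / r) ∂m = ∫ a, u a ∂m - (∫ a, v a ∂m - ∫ a, w a ∂m) / r := by
  have h : Integrable (fun a => (v a - w a) / r) m := (hv.sub hw).div_const r
  rw [integral_sub hu h, integral_div, integral_sub hv hw]

/-- The operator `P_t` on `C_∞(ℝ^d)`. -/
def IsFeller.map (hX : IsFeller X) (t : ℝ≥0) (f : C₀(Rd d, ℝ)) : C₀(Rd d, ℝ) :=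
  (hX.maps_C0 t f).choose

theorem IsFeller.map_apply (hX : IsFeller X) (t : ℝ≥0) (f : C₀(Rd d, ℝ)) (x : Rd d) :
    hX.map t f x = X.semigroup t f x :=
  (hX.maps_C0 t f).choose_spec x

theorem IsFeller.map_add (hX : IsFeller X) (s t : ℝ≥0) (f : C₀(Rd d, ℝ)) (x : Rd d) :
    hX.map (s + t) f x = X.semigroup s (hX.map t f) x := by
  rw [hX.map_apply, ← X.integral_transition _ (stronglyMeasurable_C0 f), X.transition_add,
    Kernel.integral_comp (integrable_C0_of_isFiniteMeasure f _),
    ← X.integral_transition _ (stronglyMeasurable_C0 _)]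
  refine integral_congr_ae (Eventually.of_forall fun y => ?_)
  simp only
  rw [X.integral_transition _ (stronglyMeasurable_C0 f), hX.map_apply]

theorem semigroup_sub (t : ℝ≥0) (f g : C₀(Rd d, ℝ)) (x : Rd d) :
    X.semigroup t (fun y => f y - g y) x = X.semigroup t f x - X.semigroup t g x :=
  integral_sub (integrable_C0 X t x f) (integrable_C0 X t x g)

/-- `P_t` commutes with the difference quotients and is a sup-norm contraction, so it preserves
their uniform convergence. -/
theorem IsFeller.map_mem_graph (hX : IsFeller X) {f g : C₀(Rd d, ℝ)}
    (h : (f, g) ∈ (generator X).graph) (t : ℝ≥0) :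
    (hX.map t f, hX.map t g) ∈ (generator X).graph := by
  rw [mem_graph_generator, Metric.tendstoUniformly_iff] at h ⊢
  intro ε hε
  filter_upwards [h (ε / 2) (half_pos hε)] with r hr x
  have hi := integrable_C0 X t x
  have key : hX.map t g x - (X.semigroup r (hX.map t f) x - hX.map t f x) / r =
      X.semigroup t (fun y => g y - (X.semigroup r f y - f y) / r) x := by
    have h1 : X.semigroup t (fun y => g y - (X.semigroup r f y - f y) / r) x =
        X.semigroup t g x - (X.semigroup t (hX.map r f) x - X.semigroup t f x) / r := by
      simp only [← hX.map_apply r f]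
      exact integral_sub_sub_div (hi g) (hi (hX.map r f)) (hi f) r
    rw [h1, ← hX.map_add, ← hX.map_add, add_comm r t, hX.map_apply t g, hX.map_apply t f]
  rw [Real.dist_eq, key]
  refine (X.abs_semigroup_le t (fun y => ?_) x).trans_lt (half_lt_self hε)
  rw [← Real.dist_eq]
  exact (hr y).le

theorem abs_integral_le_mul {η : Measure (Rd d)} [IsFiniteMeasure η] {g : Rd d → ℝ} {c : ℝ}
    (hg : ∀ x, |g x| ≤ c) : |∫ x, g x ∂η| ≤ c * η.real univ := by
  rw [← Real.norm_eq_abs]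
  exact norm_integral_le_of_norm_le_const (Eventually.of_forall hg)

/-- The `+ 1` keeps the denominator positive when `η = 0`. -/
theorem mul_measureReal_lt {η : Measure (Rd d)} {ε : ℝ} (hε : 0 < ε) :
    ε / (η.real univ + 1) * η.real univ < ε := by
  have h0 : 0 ≤ η.real univ := measureReal_nonneg
  rw [div_mul_eq_mul_div, div_lt_iff₀ (by linarith)]
  nlinarith

theorem IsFeller.tendsto_integral_div (hX : IsFeller X) (η : Measure (Rd d)) [IsFiniteMeasure η]
    {f g : C₀(Rd d, ℝ)} (h : (f, g) ∈ (generator X).graph) :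
    Tendsto (fun r : ℝ≥0 => ((∫ x, X.semigroup r f x ∂η) - ∫ x, f x ∂η) / (r : ℝ)) (𝓝[>] 0)
      (𝓝 (∫ x, g x ∂η)) := by
  rw [mem_graph_generator, Metric.tendstoUniformly_iff] at h
  rw [Metric.tendsto_nhds]
  intro ε hε
  have h0 : 0 ≤ η.real univ := measureReal_nonneg
  filter_upwards [h (ε / (η.real univ + 1)) (by positivity)] with r hr
  have hi := fun f : C₀(Rd d, ℝ) => integrable_C0_of_isFiniteMeasure f η
  have key : (∫ x, g x ∂η) - ((∫ x, X.semigroup r f x ∂η) - ∫ x, f x ∂η) / r =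
      ∫ x, (g x - (X.semigroup r f x - f x) / r) ∂η := by
    simp only [← hX.map_apply r f]
    exact (integral_sub_sub_div (hi g) (hi (hX.map r f)) (hi f) r).symm
  rw [dist_comm, Real.dist_eq, key]
  refine (abs_integral_le_mul fun x => ?_).trans_lt (mul_measureReal_lt hε)
  rw [← Real.dist_eq]
  exact (hr x).le

theorem IsFeller.continuous_integral (hX : IsFeller X) (η : Measure (Rd d)) [IsFiniteMeasure η]
    (f : C₀(Rd d, ℝ)) : Continuous fun t : ℝ≥0 => ∫ x, X.semigroup t f x ∂η := by
  rw [Metric.continuous_iff]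
  intro t ε hε
  have h0 : 0 ≤ η.real univ := measureReal_nonneg
  have h := Metric.tendstoUniformly_iff.1 (hX.tendsto_id f) (ε / (η.real univ + 1))
    (by positivity)
  obtain ⟨δ, hδ, hδ'⟩ := Metric.mem_nhdsWithin_iff.1 h
  -- For `s < t = s + r`, contractivity of `P_s` bounds the difference by `‖f - P_r f‖ η(ℝ^d)`, so
  -- strong continuity at `0` suffices.
  have aux : ∀ s t : ℝ≥0, s < t → dist s t < δ →
      dist (∫ x, X.semigroup s f x ∂η) (∫ x, X.semigroup t f x ∂η) < ε := by
    intro s t hst hd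
    obtain ⟨r, rfl⟩ := exists_add_of_le hst.le
    have hr : r ∈ Metric.ball 0 δ ∩ Ioi 0 := by
      refine ⟨?_, by simpa using hst⟩
      rw [NNReal.dist_eq] at hd
      simpa [NNReal.dist_eq] using hd
    have hi := fun f : C₀(Rd d, ℝ) => integrable_C0_of_isFiniteMeasure f η
    have key : (∫ x, X.semigroup s f x ∂η) - (∫ x, X.semigroup (s + r) f x ∂η) =
        ∫ x, X.semigroup s (fun y => f y - X.semigroup r f y) x ∂η := by
      simp only [← hX.map_apply r f, semigroup_sub]
      simp only [← hX.map_add, ← hX.map_apply]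
      rw [integral_sub (hi _) (hi _)]
    rw [Real.dist_eq, key]
    refine (abs_integral_le_mul fun x => ?_).trans_lt (mul_measureReal_lt hε)
    refine X.abs_semigroup_le s (fun y => ?_) x
    rw [← Real.dist_eq]
    exact (hδ' hr y).le
  refine ⟨δ, hδ, fun s hs => ?_⟩
  rcases lt_trichotomy s t with hst | rfl | hst
  · exact aux s t hst hs
  · simpa using hε
  · rw [dist_comm] at hs ⊢
    exact aux t s hst hs

theorem IsFeller.integral_semigroup_eq (hX : IsFeller X) (η : Measure (Rd d)) [IsFiniteMeasure η]
    (hη : ∀ p ∈ (generator X).graph, ∫ x, p.2 x ∂η = 0) {f g : C₀(Rd d, ℝ)}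
    (h : (f, g) ∈ (generator X).graph) (t : ℝ≥0) :
    ∫ x, X.semigroup t f x ∂η = ∫ x, X.semigroup 0 f x ∂η := by
  have hc : Continuous fun s : ℝ => ∫ x, X.semigroup s.toNNReal f x ∂η :=
    (hX.continuous_integral η f).comp continuous_real_toNNReal
  have hd : ∀ s ∈ Ico (0 : ℝ) t, HasDerivWithinAt
      (fun s : ℝ => ∫ x, X.semigroup s.toNNReal f x ∂η) 0 (Ici s) s := by
    intro s hs
    -- The generator is a limit from the right, so only a right derivative is available; with
    -- continuity this still forces constancy.
    rw [← hasDerivWithinAt_Ioi_iff_Ici, hasDerivWithinAt_iff_tendsto_slope' self_notMem_Ioi]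
    have h1 := hX.tendsto_integral_div η (hX.map_mem_graph h s.toNNReal)
    rw [hη _ (hX.map_mem_graph h s.toNNReal)] at h1
    have h2 : Tendsto (fun u : ℝ => (u - s).toNNReal) (𝓝[>] s) (𝓝[>] 0) := by
      refine tendsto_nhdsWithin_iff.2 ⟨?_, ?_⟩
      · have : Continuous fun u : ℝ => (u - s).toNNReal := by fun_prop
        simpa using (this.tendsto s).mono_left nhdsWithin_le_nhds
      · filter_upwards [self_mem_nhdsWithin] with u hu
        simpa using hu
    refine (h1.comp h2).congr' ?_
    filter_upwards [self_mem_nhdsWithin] with u hu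
    have hu : s < u := hu
    have hus : (u - s).toNNReal + s.toNNReal = u.toNNReal := by
      rw [← Real.toNNReal_add (sub_nonneg.2 hu.le) hs.1, sub_add_cancel]
    simp only [Function.comp, slope_def_field, ← hX.map_add, hus, hX.map_apply,
      Real.coe_toNNReal _ (sub_nonneg.2 hu.le)]
  have := constant_of_has_deriv_right_zero hc.continuousOn hd t ⟨t.2, le_rfl⟩
  simpa using this

theorem IsFeller.semigroup_zero (f : C₀(Rd d, ℝ)) (x : Rd d) : X.semigroup 0 f x = f x := by
  have : (fun ω => f (X.X 0 ω)) =ᵐ[X.law x] fun _ => f x := by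
    filter_upwards [X.start x] with ω hω
    rw [hω]
  rw [MarkovProcess.semigroup, integral_congr_ae this]
  simp

theorem continuous_integral_C0 (η : Measure (Rd d)) [IsFiniteMeasure η] :
    Continuous fun f : C₀(Rd d, ℝ) => ∫ x, f x ∂η := by
  refine (LipschitzWith.of_dist_le_mul (K := (η.real univ).toNNReal) fun f g => ?_).continuous
  rw [Real.dist_eq, ← integral_sub (integrable_C0_of_isFiniteMeasure f η)
    (integrable_C0_of_isFiniteMeasure g η), Real.coe_toNNReal _ measureReal_nonneg, mul_comm,
    dist_eq_norm]
  exact abs_integral_le_mul fun x => (f - g).toBCF.norm_coe_le_norm x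

/-- If the generator integrates to zero on a core, then it integrates to zero on its domain. -/
theorem integral_eq_zero_of_hasCore (η : Measure (Rd d)) [IsFiniteMeasure η]
    {D : Submodule ℝ C₀(Rd d, ℝ)} (hD : (generator X).HasCore D)
    (h : ∀ p ∈ (generator X).graph, p.1 ∈ D → ∫ x, p.2 x ∂η = 0) :
    ∀ p ∈ (generator X).graph, ∫ x, p.2 x ∂η = 0 := by
  set S := (generator X).domRestrict D with hS
  have h1 : ∀ p ∈ S.graph, ∫ x, p.2 x ∂η = 0 := by
    intro p hp
    refine h p (LinearPMap.le_graph_of_le LinearPMap.domRestrict_le hp) ?_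
    obtain ⟨y, hy, -⟩ := S.mem_graph_iff.1 hp
    rw [← hy]
    exact y.2.1
  intro p hp
  by_cases hc : S.IsClosable
  · rw [← hD.closure_eq, ← hc.graph_closure_eq_closure_graph, ← SetLike.mem_coe,
      Submodule.topologicalClosure_coe] at hp
    have hcl : IsClosed {p : C₀(Rd d, ℝ) × C₀(Rd d, ℝ) | ∫ x, p.2 x ∂η = 0} :=
      isClosed_eq ((continuous_integral_C0 η).comp continuous_snd) continuous_const
    exact closure_minimal h1 hcl hp
  -- The closure of a non-closable operator is by convention the operator itself, so this case is
  -- immediate.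
  · rw [← hD.closure_eq, LinearPMap.closure_def' hc] at hp
    exact h1 p hp

end Feller

/-! ### Finite measures are determined by test functions -/

/-- Open sets form a generating π-system. The indicator of an open `U` is a bounded pointwise limit
of test functions: a bump on a growing ball times a smooth step of `n * g`, where `g` is smooth,
nonnegative and has support `U`. -/
theorem measure_ext_of_testFn {d : ℕ} {m₁ m₂ : Measure (Rd d)} [IsFiniteMeasure m₁]
    [IsFiniteMeasure m₂] (h : ∀ f : TestFn d, ∫ x, f x ∂m₁ = ∫ x, f x ∂m₂) : m₁ = m₂ := by
  have key : ∀ U : Set (Rd d), IsOpen U → m₁ U = m₂ U := by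
    intro U hU
    obtain ⟨g, hg, hgs, hgr⟩ := hU.exists_contDiff_support_eq (n := ⊤)
    have hg0 : ∀ x, 0 ≤ g x := fun x => (hgr ⟨x, rfl⟩).1
    let χ : ℕ → ContDiffBump (0 : Rd d) := fun n =>
      ⟨n + 1, n + 2, by positivity, by linarith⟩
    have hcd : ∀ n : ℕ, ContDiff ℝ ((⊤ : ℕ∞) : WithTop ℕ∞)
        fun x => χ n x * Real.smoothTransition (n * g x) := fun n =>
      (χ n).contDiff.mul (Real.smoothTransition.contDiff.comp (contDiff_const.mul hgs))
    let F : ℕ → TestFn d := fun n =>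
      ⟨fun x => χ n x * Real.smoothTransition (n * g x), hcd n, (χ n).hasCompactSupport.mul_right,
        fun _ _ => trivial⟩
    have hF : ∀ n x, F n x = χ n x * Real.smoothTransition (n * g x) := fun _ _ => rfl
    have hlim : ∀ x, Tendsto (fun n => F n x) atTop (𝓝 (U.indicator 1 x)) := by
      intro x
      -- At each point the sequence is eventually constant: in `U` both factors become `1`, outside
      -- `U` the second is always `0`.
      refine tendsto_const_nhds.congr' ?_
      by_cases hx : x ∈ U
      · have hpos : 0 < g x := (hg0 x).lt_of_ne' (by rwa [← Function.mem_support, hg])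
        filter_upwards [eventually_ge_atTop ⌈‖x‖⌉₊, eventually_ge_atTop ⌈(g x)⁻¹⌉₊] with n h1 h2
        have h3 : χ n x = 1 := by
          refine (χ n).one_of_mem_closedBall ?_
          rw [mem_closedBall_zero_iff]
          exact (Nat.ceil_le.1 h1).trans (le_add_of_nonneg_right zero_le_one)
        have h4 : 1 ≤ n * g x := by
          have := mul_le_mul_of_nonneg_right (Nat.ceil_le.1 h2) hpos.le
          rwa [inv_mul_cancel₀ hpos.ne'] at this
        rw [hF, h3, Real.smoothTransition.one_of_one_le h4, indicator_of_mem hx, Pi.one_apply,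
          mul_one]
      · have : g x = 0 := by rwa [← hg, Function.notMem_support] at hx
        refine Eventually.of_forall fun n => ?_
        simp only
        rw [hF, this, mul_zero, Real.smoothTransition.zero, mul_zero, indicator_of_notMem hx]
    have hint : ∀ (m : Measure (Rd d)) [IsFiniteMeasure m],
        Tendsto (fun n => ∫ x, F n x ∂m) atTop (𝓝 (m.real U)) := by
      intro m _
      rw [← integral_indicator_one hU.measurableSet]
      refine tendsto_integral_of_dominated_convergence (fun _ => 1)
        (fun n => (F n).continuous.aestronglyMeasurable) (integrable_const _)
        (fun n => Eventually.of_forall fun x => ?_) (Eventually.of_forall hlim)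
      rw [hF, Real.norm_of_nonneg (mul_nonneg (χ n).nonneg (Real.smoothTransition.nonneg _))]
      exact mul_le_one₀ (χ n).le_one (Real.smoothTransition.nonneg _)
        (Real.smoothTransition.le_one _)
    have h1 := hint m₁
    simp only [h] at h1
    exact (measureReal_eq_measureReal_iff).1 (tendsto_nhds_unique h1 (hint m₂))
  refine ext_of_generate_finite _ (BorelSpace.measurable_eq (α := Rd d)) isPiSystem_isOpen
    (fun s hs => key s hs) (key _ isOpen_univ)

/-! ### Invariance and the distributional equation -/

section Invariance

variable {d : ℕ} {Ω : Type*} [MeasurableSpace Ω] {X : MarkovProcess (Rd d) Ω}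

theorem MarkovProcess.isInvariant_iff_bind (X : MarkovProcess (Rd d) Ω) (η : Measure (Rd d)) :
    X.IsInvariant η ↔ ∀ t, η.bind (X.transition t) = η := by
  refine forall_congr' fun t => ⟨fun h => ?_, fun h B hB => ?_⟩
  · ext B hB
    rw [Measure.bind_apply hB (Kernel.aemeasurable _), h B hB]
  · rw [← Measure.bind_apply hB (Kernel.aemeasurable _), h]

theorem integral_bind_transition (η : Measure (Rd d)) [IsFiniteMeasure η] (t : ℝ≥0)
    (f : C₀(Rd d, ℝ)) :
    ∫ x, f x ∂(η.bind (X.transition t)) = ∫ x, X.semigroup t f x ∂η := by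
  have h := Kernel.integral_comp (a := ()) (κ := Kernel.const Unit η) (η := X.transition t)
    (integrable_C0_of_isFiniteMeasure f _)
  rw [← Measure.comp_eq_comp_const_apply, Kernel.const_apply] at h
  rw [h]
  refine integral_congr_ae (Eventually.of_forall fun x => ?_)
  exact X.integral_transition t (stronglyMeasurable_C0 f) x

theorem solvesDistributionalEquation_iff {T : Triplet d} {π : ConvenientDecomposition T.Pi}
    {η : Measure (Rd d)} (hη : MemM T π η) :
    SolvesDistributionalEquation T π η ↔ ∀ f : TestFn d, ∫ x, T.op f x ∂η = 0 := by
  refine forall_congr' fun f => ?_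
  have i1 : Integrable (fun x => - driftIntegrand T π f x) η := (hη.drift.1 f).neg
  have i2 := hη.diffusion.1 f
  have i3 : Integrable (fun x => LevyTypeInvariant.jumpU π f x) η := hη.jumpU.1 f
  have i4 := hη.divV.1 f
  have i5 := hη.hessW.1 f
  have j1 : Integrable (fun x => - driftIntegrand T π f x + diffusionIntegrand T f x) η :=
    i1.add i2
  have j2 : Integrable (fun x => - driftIntegrand T π f x + diffusionIntegrand T f x +
    LevyTypeInvariant.jumpU π f x) η := j1.add i3
  have j3 : Integrable (fun x => - driftIntegrand T π f x + diffusionIntegrand T f x +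
    LevyTypeInvariant.jumpU π f x - divVIntegrand π f x) η := j2.sub i4
  have h : ∫ x, T.op f x ∂η = - (∫ x, driftIntegrand T π f x ∂η)
      + (∫ x, diffusionIntegrand T f x ∂η) + (∫ x, LevyTypeInvariant.jumpU π f x ∂η)
      - (∫ x, divVIntegrand π f x ∂η) + (∫ x, hessWIntegrand π f x ∂η) := by
    simp only [op_eq_integrands π f]
    rw [integral_add j3 i5, integral_sub j2 i4, integral_add j1 i3, integral_add i1 i2,
      integral_neg]
  rw [h]

end Invariance

end

end LevyTypeInvariant

/-! ### The equivalence for the process. -/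

open LevyTypeInvariant in
theorem mainTheorem6 {d : ℕ} {Ω : Type*} [MeasurableSpace Ω]
    (X : MarkovProcess (Rd d) Ω) (hX : IsRichFeller X)
    (T : Triplet d) (hT : IsLevyTypeOperator (generator X) T)
    (π : ConvenientDecomposition T.Pi)
    (η : MeasureTheory.Measure (Rd d)) [MeasureTheory.IsFiniteMeasure η] (hη : MemM T π η) :
    ((∃ D : Submodule ℝ C₀(Rd d, ℝ), (generator X).HasCore D ∧
          ∀ g ∈ D, ∃ f : TestFn d, testToC0 f = g) →
        SolvesDistributionalEquation T π η → X.IsInvariant η) ∧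
      (X.IsInvariant η → SolvesDistributionalEquation T π η) := by
  obtain ⟨hF, hR⟩ := hX
  have hgraph : ∀ f : TestFn d, (testToC0 f, generator X ⟨testToC0 f, hR f⟩) ∈
      (generator X).graph := fun f => (generator X).mem_graph ⟨testToC0 f, hR f⟩
  rw [solvesDistributionalEquation_iff hη, X.isInvariant_iff_bind]
  refine ⟨?_, fun hinv f => ?_⟩
  · rintro ⟨D, hD, hDtest⟩ hsol t
    refine measure_ext_of_testFn fun f => ?_
    have hzero := integral_eq_zero_of_hasCore η hD fun p hp hpD => by
      obtain ⟨f, hf⟩ := hDtest _ hpD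
      obtain ⟨y, hy, hy'⟩ := (generator X).mem_graph_iff.1 hp
      obtain rfl : y = ⟨testToC0 f, hR f⟩ := Subtype.ext (hy.trans hf.symm)
      rw [← hy', ← hsol f]
      exact integral_congr_ae (Eventually.of_forall fun x => hT f (hR f) x)
    refine (integral_bind_transition η t (testToC0 f)).trans ?_
    rw [hF.integral_semigroup_eq η hzero (hgraph f) t]
    simp only [IsFeller.semigroup_zero]
    rfl
  · have h := hF.tendsto_integral_div η (hgraph f)
    have h0 : ∀ r : ℝ≥0, ∫ x, X.semigroup r (testToC0 f) x ∂η = ∫ x, testToC0 f x ∂η :=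
      fun r => by rw [← integral_bind_transition, hinv r]
    -- By invariance every difference quotient is `0`, so the limit `∫ 𝒜f dη` is `0`.
    simp only [h0, sub_self, zero_div] at h
    rw [tendsto_nhds_unique tendsto_const_nhds h]
    exact integral_congr_ae (Eventually.of_forall fun x => (hT f (hR f) x).symm)
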